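/- Let $A\in\mathbb R^{n\times n}$, $B_1,B_2,B_3\in\mathbb R^{n\times m}$ and let $0\le\tau_1\le\tau_2\le\tau_3<\infty$ be known delays. Put $\tau=\tau_1+\tau_2+\tau_3$ and $B=e^{-A\tau_1}B_1+e^{-A\tau_2}B_2+e^{-A\tau_3}B_3$. Assume that $(A,B)$ is controllable and that all eigenvalues of $A$ lie on the imaginary axis. Consider $N\ge 1$ agents $$\dot x_i(t)=Ax_i(t)+\sum_{k=1}^{3}B_ku_i(t-\tau_k),\qquad i=1,\dots,N,$$ communicating over a weighted directed graph with weighted adjacency matrix $[\alpha_{ij}]$ ($\alpha_{ij}\ge 0$, $\alpha_{ii}=0$; $\alpha_{ij}\neq 0$ means that there is an edge from $j$ to $i$) that contains a directed spanning tree. Let $L=[l_{ij}]$ with $l_{ii}=\sum_j\alpha_{ij}$ and $l_{ij}=-\alpha_{ij}$ for $i\ne j$ be its Laplacian, and let $0,\lambda_2,\dots,\lambda_N$ be the eigenvalues of $L$, counted with algebraic multiplicity. Agent $i$ collects $z_i(t)=\sum_{j}\alpha_{ij}(x_i(t)-x_j(t))$. Let $\mu>0$ satisfy $\mu\ge 1/\operatorname{Re}\lambda_i$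 for $i=2,\dots,N$. For $\gamma>0$ let $P=P(\gamma)$ be the unique positive definite solution of the Riccati equation $A^{\mathsf T}P+PA-PBB^{\mathsf T}P=-\gamma P$, and put $F=-B^{\mathsf T}P$. Then there is a number $\gamma^*>0$, depending on the communication graph only through $\lambda_2,\dots,\lambda_N$ (and otherwise on $\mu$, on $A,B_1,B_2,B_3$ and on the delays), such that for every $\gamma\in(0,\gamma^*)$ the protocol $$u_i(t)=\mu Fe^{(A+BF)\tau}e^{-A\tau}z_i(t),\qquad i=1,\dots,N,$$ achieves consensus: for every continuous initial condition on $[-\tau_3,0]$ the closed-loop trajectories satisfy $\lim_{t\to\infty}\|x_i(t)-x_j(t)\|=0$ for all $i,j$. Moreover, there is a continuous reference trajectory $s$, that is, a signal with $\lim_{t\to\infty}\|x_i(t)-s(t)\|=0$ for all $i$, such that $$\|s(t)\|\le k\,(1+t^{N^*-1})\quad\text{for all } t\ge 0,$$ where $N^*$ is the maximal algebraic multiplicity of the eigenvalues of $A$ and $k$ is a positive function of the initial conditions; every other continuous reference trajectory satisfies the same bound with some positive constant in place of $k$. -/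

import Mathlib

open Matrix Filter Topology

namespace Consensus

noncomputable section

/-- The Euclidean norm of a vector of `ℝⁿ`. -/
def vecNorm {n : ℕ} (v : Fin n → ℝ) : ℝ := ‖WithLp.toLp 2 v‖

/-! ### Linear systems with three input delays -/

/-- The total delay `τ = τ₁ + τ₂ + τ₃`. -/
def totalDelay (τ : Fin 3 → ℝ) : ℝ := ∑ k, τ k

/-- The matrix `B = e^{-Aτ₁} B₁ + e^{-Aτ₂} B₂ + e^{-Aτ₃} B₃`. -/
def delayFreeInput {n m : ℕ} (A : Matrix (Fin n) (Fin n) ℝ)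
    (B : Fin 3 → Matrix (Fin n) (Fin m) ℝ) (τ : Fin 3 → ℝ) : Matrix (Fin n) (Fin m) ℝ :=
  ∑ k, NormedSpace.exp (-(τ k • A)) * B k

/-- The controllability matrix `[B, AB, …, A^{n-1}B]`. -/
def controllabilityMatrix {n m : ℕ} (A : Matrix (Fin n) (Fin n) ℝ)
    (B : Matrix (Fin n) (Fin m) ℝ) : Matrix (Fin n) (Fin n × Fin m) ℝ :=
  Matrix.of fun i p => (A ^ (p.1 : ℕ) * B) i p.2

/-- The pair `(A, B)` is controllable. -/
def IsControllable {n m : ℕ} (A : Matrix (Fin n) (Fin n) ℝ)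
    (B : Matrix (Fin n) (Fin m) ℝ) : Prop :=
  (controllabilityMatrix A B).rank = n

/-- The complex characteristic roots of a real square matrix, with algebraic multiplicity. -/
def eigenvalueMultiset {n : ℕ} (A : Matrix (Fin n) (Fin n) ℝ) : Multiset ℂ :=
  (A.map (algebraMap ℝ ℂ)).charpoly.roots

/-- The maximal algebraic multiplicity of the (complex) eigenvalues of `A`. -/
def maxAlgMultiplicity {n : ℕ} (A : Matrix (Fin n) (Fin n) ℝ) : ℕ :=
  (eigenvalueMultiset A).toFinset.sup fun l => (eigenvalueMultiset A).count l

/-- `P` is a positive definite solution of the parametric algebraic Riccati equation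
`Aᵀ P + P A - P B Bᵀ P = -γ P`. -/
structure IsPosDefRiccatiSolution {n m : ℕ} (A : Matrix (Fin n) (Fin n) ℝ)
    (B : Matrix (Fin n) (Fin m) ℝ) (γ : ℝ) (P : Matrix (Fin n) (Fin n) ℝ) : Prop where
  posDef : P.PosDef
  riccati : Aᵀ * P + P * A - P * B * Bᵀ * P = -(γ • P)

/-- The protocol gain `μ F e^{(A+BF)T} e^{-AT}`. -/
def protocolGain {n m : ℕ} (A : Matrix (Fin n) (Fin n) ℝ) (B : Matrix (Fin n) (Fin m) ℝ)
    (F : Matrix (Fin m) (Fin n) ℝ) (μ T : ℝ) : Matrix (Fin m) (Fin n) ℝ :=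
  μ • (F * NormedSpace.exp (T • (A + B * F)) * NormedSpace.exp (-(T • A)))

/-! ### Communication topology -/

/-- A weighted directed graph on the agents `Fin N`, given by its weighted adjacency matrix. The
weights are nonnegative and there are no self-loops; `weight i j` is the weight of the edge from
`j` to `i`, along which agent `i` receives information from agent `j`. -/
structure WeightedDigraph (N : ℕ) where
  weight : Matrix (Fin N) (Fin N) ℝ
  weight_nonneg : ∀ i j, 0 ≤ weight i j
  weight_self : ∀ i, weight i i = 0

namespace WeightedDigraph

/-- There is an edge from `j` to `i`. -/
def Edge {N : ℕ} (G : WeightedDigraph N) (j i : Fin N) : Prop := G.weight i j ≠ 0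

/-- The Laplacian: `lᵢᵢ = ∑ⱼ αᵢⱼ`, and `lᵢⱼ = -αᵢⱼ` for `i ≠ j`. -/
def laplacian {N : ℕ} (G : WeightedDigraph N) : Matrix (Fin N) (Fin N) ℝ :=
  Matrix.diagonal (fun i => ∑ j, G.weight i j) - G.weight

/-- `T` (where `T j i` means that `j` is a parent of `i`) is the edge relation of a directed tree
on all nodes: the root `r` has no parent, every other node has exactly one parent, and there is a
directed path from `r` to every node. -/
structure IsDirectedTree {N : ℕ} (T : Fin N → Fin N → Prop) (r : Fin N) : Prop where
  root_no_parent : ∀ j, ¬ T j r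
  unique_parent : ∀ i, i ≠ r → ∃! j, T j i
  path : ∀ i, Relation.ReflTransGen T r i

/-- The graph contains a directed spanning tree. -/
def HasDirectedSpanningTree {N : ℕ} (G : WeightedDigraph N) : Prop :=
  ∃ (T : Fin N → Fin N → Prop) (r : Fin N), IsDirectedTree T r ∧ ∀ j i, T j i → G.Edge j i

end WeightedDigraph

/-! ### The multi-agent system -/

/-- The information `zᵢ(t) = ∑ⱼ αᵢⱼ (xᵢ(t) - xⱼ(t))` collected by agent `i`. -/
def collected {N n : ℕ} (G : WeightedDigraph N) (x : Fin N → ℝ → Fin n → ℝ)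
    (i : Fin N) (t : ℝ) : Fin n → ℝ :=
  ∑ j, G.weight i j • (x i t - x j t)

/-- The states `x` and inputs `u` of the agents form a trajectory of the closed-loop system
`ẋᵢ(t) = A xᵢ(t) + ∑ₖ Bₖ uᵢ(t - τₖ)` for `t ≥ 0`, with `uᵢ(t) = K zᵢ(t)`. The states are
continuous on `[-τ₃, ∞)`; values at times before `-τ₃` are irrelevant. -/
structure IsClosedLoopTrajectory {N n m : ℕ} (A : Matrix (Fin n) (Fin n) ℝ)
    (B : Fin 3 → Matrix (Fin n) (Fin m) ℝ) (τ : Fin 3 → ℝ) (G : WeightedDigraph N)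
    (K : Matrix (Fin m) (Fin n) ℝ) (x : Fin N → ℝ → Fin n → ℝ) (u : Fin N → ℝ → Fin m → ℝ) :
    Prop where
  continuousOn : ∀ i, ContinuousOn (x i) (Set.Ici (-τ 2))
  dynamics : ∀ i, ∀ t, 0 ≤ t →
    HasDerivWithinAt (x i) (A *ᵥ x i t + ∑ k, B k *ᵥ u i (t - τ k)) (Set.Ici 0) t
  protocol : ∀ i, ∀ t, -τ 2 ≤ t → u i t = K *ᵥ collected G x i t

/-- The agents achieve consensus: `‖xᵢ(t) - xⱼ(t)‖ → 0` for all `i, j`. -/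
def AchievesConsensus {N n : ℕ} (x : Fin N → ℝ → Fin n → ℝ) : Prop :=
  ∀ i j, Tendsto (fun t => vecNorm (x i t - x j t)) atTop (𝓝 0)

/-- `s` is a reference trajectory: `‖xᵢ(t) - s(t)‖ → 0` for all `i`. -/
def IsReference {N n : ℕ} (x : Fin N → ℝ → Fin n → ℝ) (s : ℝ → Fin n → ℝ) : Prop :=
  ∀ i, Tendsto (fun t => vecNorm (x i t - s t)) atTop (𝓝 0)

end

end Consensus

namespace Consensus

noncomputable section

/-! ### Semigroup bounds and the reduction of input delays -/

section Stability

variable {E U : Type*} [NormedAddCommGroup E] [InnerProductSpace ℂ E]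
  [NormedAddCommGroup U] [InnerProductSpace ℂ U]

/-! Low gain makes both the predictor factor and the delays small perturbations. Inverting the
Riccati equation turns it into the linear Lyapunov equation `A W + W Aᵀ + γ W = B Bᵀ` for `W = P⁻¹`.
Taking traces, with `tr A = 0` because the spectrum is imaginary, gives `tr (Bᵀ P B) = n γ`. In
coordinates where `P` becomes the identity, `B` therefore has norm `O(√γ)` and `2 Re ⟨y, A y⟩ = ‖B*
y‖² - γ ‖y‖²`. Monotonicity of `P` in `γ` bounds the transformed `Bₖ` uniformly for `γ ≤ 1`, so
every constant can be fixed before `γ`.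

Consider one mode `ẋ = A x + ∑ₖ Bₖ w(t - τₖ)` with `w = λ K x + d` and `d → 0`. Adding the
distributed terms `delayTerm` to `x` gives `y` with `ẏ = A y + B w`. Since `μ Re λ ≥ 1`, `‖y‖²`
decays at rate `γ` up to the square of the error `λ (K x + μ B* y) + d`. The `x` part of this error
is `O(γ) sup ‖x‖`: one factor `√γ` comes from `B*`, another from `x - y`, and the predictor differs
from the identity by `O(γ)`. Dividing the squared error by `γ` leaves a loop gain `O(√γ)`, and
`tendsto_zero_of_small_gain` closes the loop. This is `tendsto_zero_of_mode`.

The network is handled without a Jordan form. If `M` commutes with `L`, the combination `M x` is a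
mode for `λ` disturbed by `(L - λ) M x`. Cayley–Hamilton gives `χ_L(L) x = 0`, and peeling off the
factors `X - λᵢ` one at a time leaves `L x → 0` (`tendsto_laplacian_zero`). The spanning tree makes
`0` an algebraically simple eigenvalue and Gershgorin puts the others in the open right half-plane.
So `χ_L = X p` with `p(0) ≠ 0`, and `Q = p(L) / p(0)` projects onto constant vectors. The rows of `Q
x` all equal one solution of `ṡ = A s`, and `x - Q x` is a fixed combination of `L x`. The growth of
`s` is that of `e^{tA}`, which is polynomial by primary decomposition. -/

lemma hasDerivWithinAt_norm_sq {z : ℝ → E} {z' : E} {s : Set ℝ} {t : ℝ}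
    (hz : HasDerivWithinAt z z' s t) :
    HasDerivWithinAt (fun r => ‖z r‖ ^ 2) (2 * (inner ℂ (z t) z').re) s t := by
  let _ : InnerProductSpace ℝ E := InnerProductSpace.rclikeToReal ℂ E
  exact hz.norm_sq

lemma hasDerivAt_norm_sq {z : ℝ → E} {z' : E} {t : ℝ} (hz : HasDerivAt z z' t) :
    HasDerivAt (fun r => ‖z r‖ ^ 2) (2 * (inner ℂ (z t) z').re) t :=
  hasDerivWithinAt_univ.1 (hasDerivWithinAt_norm_sq hz.hasDerivWithinAt)

variable [CompleteSpace E]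

lemma hasDerivAt_exp_smul_apply (G : E →L[ℂ] E) (y : E) (s : ℝ) :
    HasDerivAt (fun r : ℝ => NormedSpace.exp (r • G) y) (G (NormedSpace.exp (s • G) y)) s := by
  have h := hasDerivAt_exp_smul_const' (𝕂 := ℝ) G s
  exact ((ContinuousLinearMap.apply ℂ E y).restrictScalars ℝ).hasFDerivAt.comp_hasDerivAt s h

lemma continuous_exp_smul (G : E →L[ℂ] E) :
    Continuous fun r : ℝ => NormedSpace.exp (r • G) :=
  continuous_iff_continuousAt.2 fun s =>
    (hasDerivAt_exp_smul_const' (𝕂 := ℝ) G s).continuousAt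

lemma exp_add_smul (G : E →L[ℂ] E) (r s : ℝ) :
    NormedSpace.exp ((r + s) • G) = NormedSpace.exp (r • G) * NormedSpace.exp (s • G) := by
  let _ : NormedAlgebra ℚ (E →L[ℂ] E) := NormedAlgebra.restrictScalars ℚ ℂ _
  rw [add_smul, NormedSpace.exp_add_of_commute]
  exact ((Commute.refl G).smul_left r).smul_right s

/-- A bound on the numerical range bounds the growth of the semigroup. -/
lemma norm_exp_smul_apply_le (G : E →L[ℂ] E) {a : ℝ} (h : ∀ y, (inner ℂ y (G y)).re ≤ a * ‖y‖ ^ 2)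
    {s : ℝ} (hs : 0 ≤ s) (y : E) :
    ‖NormedSpace.exp (s • G) y‖ ≤ Real.exp (a * s) * ‖y‖ := by
  let z : ℝ → E := fun r => NormedSpace.exp (r • G) y
  -- The bound on the numerical range says exactly that this weighted energy is nonincreasing.
  let f : ℝ → ℝ := fun r => Real.exp (-(2 * a) * r) * ‖z r‖ ^ 2
  have hf : ∀ r, HasDerivAt f (Real.exp (-(2 * a) * r) * (-(2 * a)) * ‖z r‖ ^ 2
      + Real.exp (-(2 * a) * r) * (2 * (inner ℂ (z r) (G (z r))).re)) r := by
    intro r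
    have h1 : HasDerivAt (fun r : ℝ => Real.exp (-(2 * a) * r))
        (Real.exp (-(2 * a) * r) * (-(2 * a))) r := by
      simpa using ((hasDerivAt_id r).const_mul (-(2 * a))).exp
    exact h1.mul (hasDerivAt_norm_sq (hasDerivAt_exp_smul_apply G y r))
  have hanti : Antitone f := by
    refine antitone_of_deriv_nonpos (fun r => (hf r).differentiableAt) fun r => ?_
    rw [(hf r).deriv]
    have := h (z r)
    have he := Real.exp_pos (-(2 * a) * r)
    nlinarith [mul_le_mul_of_nonneg_left this he.le]
  have h0 : f s ≤ f 0 := hanti hs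
  have h1 : ‖z s‖ ^ 2 ≤ (Real.exp (a * s) * ‖y‖) ^ 2 := by
    have e1 : f 0 = ‖y‖ ^ 2 := by simp [f, z]
    have e2 : Real.exp (a * s) ^ 2 * Real.exp (-(2 * a) * s) = 1 := by
      rw [← Real.exp_nat_mul, ← Real.exp_add]; norm_num; ring
    calc ‖z s‖ ^ 2 = Real.exp (a * s) ^ 2 * f s := by
          simp only [f]; rw [← mul_assoc, e2, one_mul]
      _ ≤ Real.exp (a * s) ^ 2 * ‖y‖ ^ 2 := by
          rw [← e1]; gcongr
      _ = _ := by ring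
  exact le_of_sq_le_sq h1 (by positivity)

lemma norm_exp_smul_apply_le_abs (G : E →L[ℂ] E) {a : ℝ}
    (h : ∀ y, |(inner ℂ y (G y)).re| ≤ a * ‖y‖ ^ 2) (s : ℝ) (y : E) :
    ‖NormedSpace.exp (s • G) y‖ ≤ Real.exp (a * |s|) * ‖y‖ := by
  rcases le_total 0 s with hs | hs
  · rw [abs_of_nonneg hs]
    exact norm_exp_smul_apply_le G (fun y => (le_abs_self _).trans (h y)) hs y
  · rw [abs_of_nonpos hs]
    have := norm_exp_smul_apply_le (-G) (a := a) (fun y => by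
      simpa [inner_neg_right] using (neg_le_abs _).trans (h y)) (neg_nonneg.2 hs) y
    simpa using this

/-- The predictor factor `e^{T(A-BB*)} e^{-TA}` is close to the identity when `B` is small. -/
lemma norm_predictor_sub_le [CompleteSpace U] (A : E →L[ℂ] E) (B : U →L[ℂ] E) {a T : ℝ} (hT : 0 ≤ T) (ha : 0 ≤ a)
    (h : ∀ y, |(inner ℂ y (A y)).re| ≤ a * ‖y‖ ^ 2)
    (hG : ∀ y, (inner ℂ y ((A - B ∘L B.adjoint) y)).re ≤ 0) (x : E) :
    ‖NormedSpace.exp (T • (A - B ∘L B.adjoint)) (NormedSpace.exp (-(T • A)) x) - x‖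
      ≤ T * (‖B‖ ^ 2 * Real.exp (a * T)) * ‖x‖ := by
  set G := A - B ∘L B.adjoint with hGdef
  -- Interpolates between `x` and the predicted vector. Its derivative contains only `G - A = -B
  -- B*`, and `e^{sG}` is a contraction because `G` is dissipative.
  let f : ℝ → E := fun s => (NormedSpace.exp (s • G) * NormedSpace.exp (s • (-A))) x
  have hf : ∀ s, HasDerivAt f (NormedSpace.exp (s • G) ((G - A) (NormedSpace.exp (s • (-A)) x))) s := by
    intro s
    have h1 := (hasDerivAt_exp_smul_const (𝕂 := ℝ) G s).mul
      (hasDerivAt_exp_smul_const' (𝕂 := ℝ) (-A) s)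
    have h2 := ((ContinuousLinearMap.apply ℂ E x).restrictScalars ℝ).hasFDerivAt.comp_hasDerivAt s h1
    refine h2.congr_deriv ?_
    simp [sub_eq_add_neg]
  have hb : ∀ s ∈ Set.Icc 0 T,
      ‖NormedSpace.exp (s • G) ((G - A) (NormedSpace.exp (s • (-A)) x))‖
        ≤ ‖B‖ ^ 2 * Real.exp (a * T) * ‖x‖ := by
    intro s hs
    have h1 := norm_exp_smul_apply_le G (a := 0) (fun y => by simpa using hG y) hs.1
      ((G - A) (NormedSpace.exp (s • (-A)) x))
    rw [zero_mul, Real.exp_zero, one_mul] at h1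
    refine h1.trans ?_
    have h2 : ‖G - A‖ ≤ ‖B‖ ^ 2 := by
      rw [hGdef, sub_sub_cancel_left, norm_neg, sq]
      refine (ContinuousLinearMap.opNorm_comp_le _ _).trans ?_
      simp
    have h3 := norm_exp_smul_apply_le_abs (-A) (a := a) (fun y => by
      simpa [inner_neg_right] using h y) s x
    rw [abs_of_nonneg hs.1] at h3
    calc _ ≤ ‖G - A‖ * ‖NormedSpace.exp (s • (-A)) x‖ := ContinuousLinearMap.le_opNorm _ _
      _ ≤ ‖B‖ ^ 2 * (Real.exp (a * s) * ‖x‖) := by gcongr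
      _ ≤ ‖B‖ ^ 2 * (Real.exp (a * T) * ‖x‖) := by gcongr; exact hs.2
      _ = _ := by ring
  have := (convex_Icc (0 : ℝ) T).norm_image_sub_le_of_norm_hasDerivWithin_le
    (fun s _ => (hf s).hasDerivWithinAt) hb (Set.left_mem_Icc.2 hT) (Set.right_mem_Icc.2 hT)
  have e0 : f 0 = x := by simp [f]
  have e1 : f T = NormedSpace.exp (T • G) (NormedSpace.exp (-(T • A)) x) := by simp [f]
  rw [e0, e1, sub_zero, Real.norm_of_nonneg hT] at this
  linarith

/-- The distributed term of the reduction of an input delay. -/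
def delayTerm (A : E →L[ℂ] E) (B : U →L[ℂ] E) (τ : ℝ) (w : ℝ → U) (t : ℝ) : E :=
  ∫ s in (t - τ)..t, NormedSpace.exp ((t - s - τ) • A) (B (w s))

/-- Pulling out `e^{(t-τ)A}` leaves an integrand independent of `t`, so only the two endpoints
contribute. The term `-B w(t - τ)` is what cancels the delayed input when this is added to the
state. -/
lemma hasDerivAt_delayTerm (A : E →L[ℂ] E) (B : U →L[ℂ] E) (τ : ℝ) {w : ℝ → U}
    (hw : Continuous w) (t : ℝ) :
    HasDerivAt (delayTerm A B τ w)
      (A (delayTerm A B τ w t) + NormedSpace.exp (-(τ • A)) (B (w t)) - B (w (t - τ))) t := by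
  let g : ℝ → E := fun s => NormedSpace.exp ((-s) • A) (B (w s))
  have hg : Continuous g :=
    ((continuous_exp_smul A).comp continuous_neg).clm_apply (B.continuous.comp hw)
  let Φ : ℝ → E := fun t => ∫ s in (0 : ℝ)..t, g s
  have hΦ : ∀ t, HasDerivAt Φ (g t) t := fun t =>
    intervalIntegral.integral_hasDerivAt_right (hg.intervalIntegrable _ _)
      (hg.stronglyMeasurableAtFilter _ _) hg.continuousAt
  have heq : delayTerm A B τ w =
      fun t => NormedSpace.exp ((t - τ) • A) (Φ t - Φ (t - τ)) := by
    funext t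
    have h1 : Φ t - Φ (t - τ) = ∫ s in (t - τ)..t, g s :=
      intervalIntegral.integral_interval_sub_left (hg.intervalIntegrable _ _)
        (hg.intervalIntegrable _ _)
    rw [h1, delayTerm, ← ContinuousLinearMap.intervalIntegral_comp_comm _
      (hg.intervalIntegrable _ _)]
    refine intervalIntegral.integral_congr fun s _ => ?_
    simp only [g]
    rw [← mul_apply_eq_comp, ← exp_add_smul]
    congr 3; ring
  rw [heq]
  have h1 : HasDerivAt (fun t => Φ t - Φ (t - τ)) (g t - g (t - τ)) t := by
    have := (hΦ (t - τ)).comp_sub_const t τ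
    exact (hΦ t).sub this
  have h2 : HasDerivAt (fun t : ℝ => NormedSpace.exp ((t - τ) • A))
      (A * NormedSpace.exp ((t - τ) • A)) t :=
    (hasDerivAt_exp_smul_const' (𝕂 := ℝ) A (t - τ)).comp_sub_const t τ
  have h3 : HasDerivAt (fun t : ℝ => NormedSpace.exp ((t - τ) • A) (Φ t - Φ (t - τ)))
      ((A * NormedSpace.exp ((t - τ) • A)) (Φ t - Φ (t - τ))
        + NormedSpace.exp ((t - τ) • A) (g t - g (t - τ))) t := by
    have h2' := ((ContinuousLinearMap.restrictScalarsL ℂ E E ℝ ℝ).hasFDerivAt.comp_hasDerivAt t h2)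
    exact h2'.clm_apply h1
  refine h3.congr_deriv ?_
  have e1 : NormedSpace.exp ((t - τ) • A) (g t) = NormedSpace.exp (-(τ • A)) (B (w t)) := by
    simp only [g]
    rw [← mul_apply_eq_comp, ← exp_add_smul]
    congr 2
    rw [← neg_smul]; congr 1; ring_nf
  have e2 : NormedSpace.exp ((t - τ) • A) (g (t - τ)) = B (w (t - τ)) := by
    simp only [g]
    rw [← mul_apply_eq_comp, ← exp_add_smul]
    simp
  rw [map_sub (NormedSpace.exp ((t - τ) • A)) (g t), e1, e2]
  simp only [mul_apply_eq_comp]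
  abel

lemma norm_delayTerm_le (A : E →L[ℂ] E) (B : U →L[ℂ] E) {τ a b W : ℝ} (hτ : 0 ≤ τ) (ha : 0 ≤ a)
    (h : ∀ y, |(inner ℂ y (A y)).re| ≤ a * ‖y‖ ^ 2) (hb : ‖B‖ ≤ b) {w : ℝ → U} {t : ℝ}
    (hW : ∀ s ∈ Set.Icc (t - τ) t, ‖w s‖ ≤ W) :
    ‖delayTerm A B τ w t‖ ≤ τ * (Real.exp (a * τ) * b) * W := by
  have hb0 : 0 ≤ b := (norm_nonneg _).trans hb
  have := intervalIntegral.norm_integral_le_of_norm_le_const (a := t - τ) (b := t)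
    (f := fun s => NormedSpace.exp ((t - s - τ) • A) (B (w s)))
    (C := Real.exp (a * τ) * b * W) (fun s hs => by
      rw [Set.uIoc_of_le (by linarith)] at hs
      have hs' : s ∈ Set.Icc (t - τ) t := ⟨hs.1.le, hs.2⟩
      refine (norm_exp_smul_apply_le_abs A h _ _).trans ?_
      have h1 : |t - s - τ| ≤ τ := abs_le.2 ⟨by linarith [hs'.2], by linarith [hs'.1]⟩
      have h2 : ‖B (w s)‖ ≤ b * W := (B.le_opNorm _).trans (by
        gcongr; exact hW s hs')
      rw [mul_assoc]
      gcongr)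
  rw [delayTerm]
  refine this.trans (le_of_eq ?_)
  rw [sub_sub_cancel, abs_of_nonneg hτ]; ring

end Stability

/-! ### Small-gain and comparison estimates -/

section SmallGain

/-- A continuous nonnegative function which satisfies a delayed small-gain estimate with gain
`1 / 2`, forced by a vanishing disturbance, tends to zero. -/
lemma tendsto_zero_of_small_gain {g d c : ℝ → ℝ} {h a C : ℝ} (hg : Continuous g)
    (hg0 : ∀ t, 0 ≤ g t) (hd : Continuous d) (hdlim : Tendsto d atTop (𝓝 0)) (ha : 0 < a) (hC : 0 ≤ C)
    (H : ∀ t₀, 0 ≤ t₀ → ∀ t, t₀ ≤ t → ∀ X D, (∀ s ∈ Set.Icc (t₀ - h) t, g s ≤ X) →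
      (∀ s ∈ Set.Icc (t₀ - h) t, d s ≤ D) →
      g t ≤ Real.exp (-a * (t - t₀)) * c t₀ + X / 2 + C * D) :
    Tendsto g atTop (𝓝 0) := by
  obtain ⟨D₀, hD₀⟩ : ∃ D₀, ∀ s, -h ≤ s → d s ≤ D₀ := by
    obtain ⟨T, hT⟩ := eventually_atTop.1 (hdlim.eventually (ge_mem_nhds zero_lt_one))
    obtain ⟨D₁, hD₁⟩ := (isCompact_Icc (a := -h) (b := T)).bddAbove_image hd.continuousOn
    refine ⟨max D₁ 1, fun s hs => ?_⟩
    rcases le_total s T with h1 | h1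
    · exact le_max_of_le_left (hD₁ ⟨s, ⟨hs, h1⟩, rfl⟩)
    · exact le_max_of_le_right (hT s h1)
  obtain ⟨X₀, hX₀⟩ : ∃ X₀, ∀ s, -h ≤ s → g s ≤ X₀ := by
    obtain ⟨M, hM⟩ := (isCompact_Icc (a := -h) (b := 0)).bddAbove_image hg.continuousOn
    -- At a maximum point `r ≥ 0` of `g` on `[-h, s]` the estimate from `t₀ = 0` applies with `X = g
    -- r`. The term `X / 2` is then absorbed on the left, which doubles the rest.
    refine ⟨max M (2 * (|c 0| + C * D₀)), fun s hs => ?_⟩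
    rcases le_total s 0 with h1 | h1
    · exact le_max_of_le_left (hM ⟨s, ⟨hs, h1⟩, rfl⟩)
    obtain ⟨r, hr, hmax⟩ := (isCompact_Icc (a := -h) (b := s)).exists_isMaxOn
      ⟨s, hs, le_rfl⟩ hg.continuousOn
    refine (hmax (Set.right_mem_Icc.2 hs)).trans ?_
    rcases le_total r 0 with h2 | h2
    · exact le_max_of_le_left (hM ⟨r, ⟨hr.1, h2⟩, rfl⟩)
    · refine le_max_of_le_right ?_
      have h3 := H 0 le_rfl r h2 (g r) D₀
        (fun q hq => hmax ⟨by linarith [hq.1], hq.2.trans hr.2⟩)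
        (fun q hq => hD₀ q (by linarith [hq.1]))
      have h4 : Real.exp (-a * (r - 0)) * c 0 ≤ |c 0| := by
        calc _ ≤ Real.exp (-a * (r - 0)) * |c 0| := by gcongr; exact le_abs_self _
          _ ≤ 1 * |c 0| := by
              gcongr
              exact Real.exp_le_one_iff.2 (by nlinarith)
          _ = _ := one_mul _
      linarith
  -- An eventual bound contracts by `3/4 = 1/8 + 1/2 + 1/8`: decayed initial term, gain,
  -- disturbance.
  have step : ∀ X, 0 < X → (∀ᶠ t in atTop, g t ≤ X) → ∀ᶠ t in atTop, g t ≤ 3 / 4 * X := by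
    intro X hX hgX
    have hD : 0 < X / (8 * (C + 1)) := by positivity
    obtain ⟨T, hT⟩ := eventually_atTop.1 (hgX.and (hdlim.eventually (ge_mem_nhds hD)))
    set t₀ := max 0 (T + h)
    have hlim : Tendsto (fun t => Real.exp (-a * (t - t₀)) * c t₀) atTop (𝓝 0) := by
      have h1 : Tendsto (fun t : ℝ => -a * (t - t₀)) atTop atBot :=
        (tendsto_atTop_add_const_right _ (-t₀) tendsto_id).const_mul_atTop_of_neg
          (neg_neg_of_pos ha)
      simpa using (Real.tendsto_exp_atBot.comp h1).mul_const (c t₀)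
    filter_upwards [hlim.eventually (ge_mem_nhds (show 0 < X / 8 by positivity)),
      eventually_ge_atTop t₀] with t ht htt
    have hwin : ∀ s ∈ Set.Icc (t₀ - h) t, T ≤ s := fun s hs => by
      linarith [le_max_right 0 (T + h), hs.1]
    have h3 := H t₀ (le_max_left _ _) t htt X (X / (8 * (C + 1)))
      (fun s hs => (hT s (hwin s hs)).1) (fun s hs => (hT s (hwin s hs)).2)
    have h4 : C * (X / (8 * (C + 1))) ≤ X / 8 := by
      rw [mul_div_assoc', div_le_div_iff₀ (by positivity) (by positivity)]
      nlinarith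
    linarith
  have hX1 : 0 < max X₀ 1 := lt_max_of_lt_right one_pos
  have iter : ∀ n : ℕ, ∀ᶠ t in atTop, g t ≤ (3 / 4) ^ n * max X₀ 1 := by
    intro n
    induction n with
    | zero =>
      filter_upwards [eventually_ge_atTop (-h)] with t ht
      rw [pow_zero, one_mul]
      exact (hX₀ t ht).trans (le_max_left _ _)
    | succ n ih =>
      have := step _ (by positivity) ih
      filter_upwards [this] with t ht
      rw [pow_succ']; linarith
  have hpow : Tendsto (fun n : ℕ => (3 / 4 : ℝ) ^ n * max X₀ 1) atTop (𝓝 0) := by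
    simpa using (tendsto_pow_atTop_nhds_zero_of_lt_one (by norm_num : (0 : ℝ) ≤ 3 / 4)
      (by norm_num)).mul_const (max X₀ 1)
  refine Metric.tendsto_atTop'.2 fun ε hε => ?_
  obtain ⟨n, hn⟩ := (hpow.eventually (gt_mem_nhds hε)).exists
  obtain ⟨T, hT⟩ := eventually_atTop.1 (iter n)
  refine ⟨T, fun t ht => ?_⟩
  rw [Real.dist_eq, sub_zero, abs_of_nonneg (hg0 t)]
  exact (hT t ht.le).trans_lt hn

/-- Grönwall: `e^{γ(t-t₀)} (V - c/γ)` is nonincreasing, and the favourable term `-e^{-γ(t₁-t₀)} c/γ`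
is dropped. -/
lemma le_exp_mul_add_of_deriv_le {V V' : ℝ → ℝ} {γ c t₀ t₁ : ℝ} (hγ : 0 < γ) (hc : 0 ≤ c)
    (ht : t₀ ≤ t₁) (hV : ∀ t ∈ Set.Icc t₀ t₁, HasDerivWithinAt V (V' t) (Set.Icc t₀ t₁) t)
    (h : ∀ t ∈ Set.Icc t₀ t₁, V' t ≤ -γ * V t + c) :
    V t₁ ≤ Real.exp (-γ * (t₁ - t₀)) * V t₀ + c / γ := by
  let f : ℝ → ℝ := fun t => Real.exp (γ * (t - t₀)) * (V t - c / γ)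
  have hf : ∀ t ∈ Set.Icc t₀ t₁, HasDerivWithinAt f (Real.exp (γ * (t - t₀)) * γ * (V t - c / γ)
      + Real.exp (γ * (t - t₀)) * V' t) (Set.Icc t₀ t₁) t := by
    intro t ht
    have h1 : HasDerivAt (fun r : ℝ => Real.exp (γ * (r - t₀))) (Real.exp (γ * (t - t₀)) * γ) t := by
      simpa using (((hasDerivAt_id t).sub_const t₀).const_mul γ).exp
    exact h1.hasDerivWithinAt.mul ((hV t ht).sub_const _)
  have hanti : AntitoneOn f (Set.Icc t₀ t₁) := by
    refine antitoneOn_of_hasDerivWithinAt_nonpos (convex_Icc _ _)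
      (fun t ht => (hf t ht).continuousWithinAt)
      (fun t ht => (hf t (interior_subset ht)).mono interior_subset) fun t ht => ?_
    have h1 := h t (interior_subset ht)
    have h2 : Real.exp (γ * (t - t₀)) * γ * (V t - c / γ) + Real.exp (γ * (t - t₀)) * V' t
        = Real.exp (γ * (t - t₀)) * (V' t - (-γ * V t + c)) := by
      field_simp; ring
    rw [h2]
    exact mul_nonpos_of_nonneg_of_nonpos (Real.exp_pos _).le (by linarith)
  have h1 := hanti (Set.left_mem_Icc.2 ht) (Set.right_mem_Icc.2 ht) ht
  simp only [f, sub_self, mul_zero, Real.exp_zero, one_mul] at h1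
  have h2 : Real.exp (-γ * (t₁ - t₀)) * Real.exp (γ * (t₁ - t₀)) = 1 := by
    rw [← Real.exp_add]; simp
  have h3 := mul_le_mul_of_nonneg_left h1 (Real.exp_pos (-γ * (t₁ - t₀))).le
  rw [← mul_assoc, h2, one_mul] at h3
  have h4 : 0 ≤ Real.exp (-γ * (t₁ - t₀)) * (c / γ) := by positivity
  linarith

end SmallGain

/-! ### Stability of a single mode -/

section Stability

variable {E U : Type*} [NormedAddCommGroup E] [InnerProductSpace ℂ E] [CompleteSpace E]
  [NormedAddCommGroup U] [InnerProductSpace ℂ U] [CompleteSpace U]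

/-- The Lyapunov inequality for the reduced system `ẏ = A y + B w` with
`w = λ(δ - μ B* y) + d`. -/
lemma lyapunov_derivative_le (A : E →L[ℂ] E) (B : U →L[ℂ] E) {γ μ : ℝ} {l : ℂ}
    (hl : 1 ≤ μ * l.re) {y : E}
    (hy : 2 * (inner ℂ y (A y)).re = ‖B.adjoint y‖ ^ 2 - γ * ‖y‖ ^ 2) (e : U) :
    2 * (inner ℂ y (A y + B (-((l * μ) • B.adjoint y) + e))).re ≤ -γ * ‖y‖ ^ 2 + ‖e‖ ^ 2 := by
  set b := B.adjoint y with hb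
  have h1 : (inner ℂ y (B (-((l * μ) • b) + e))).re
      = -(μ * l.re * ‖b‖ ^ 2) + (inner ℂ b e).re := by
    rw [← ContinuousLinearMap.adjoint_inner_left, inner_add_right, inner_neg_right,
      inner_smul_right, inner_self_eq_norm_sq_to_K, ← hb]
    have : (((‖b‖ : ℝ) : ℂ)) ^ 2 = ((‖b‖ ^ 2 : ℝ) : ℂ) := by push_cast; rfl
    simp only [Complex.coe_algebraMap, this]
    simp only [Complex.add_re, Complex.neg_re, Complex.mul_re, Complex.mul_im, Complex.ofReal_re,
      Complex.ofReal_im]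
    ring
  have h2 : (inner ℂ b e).re ≤ ‖b‖ * ‖e‖ := re_inner_le_norm (𝕜 := ℂ) b e
  rw [inner_add_right, Complex.add_re, mul_add, hy, h1]
  -- The feedback contributes at most `-2 ‖b‖²` and the Riccati term `+‖b‖²`. What remains, `-‖b‖² +
  -- 2 ‖b‖ ‖e‖`, is at most `‖e‖²`.
  nlinarith [sq_nonneg (‖b‖ - ‖e‖), mul_nonneg (sub_nonneg.2 hl) (sq_nonneg ‖b‖)]

/-- The gain constant of the reduction error. -/
def reductionConst (c b μ ℓ H T : ℝ) : ℝ :=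
  3 * H * Real.exp (c * (H + T)) * b * (ℓ * (μ * √c * Real.exp (c * (H + T))) + 1)

/-- The gain constant of the Lyapunov estimate. -/
def lyapunovConst (c b μ ℓ H T : ℝ) : ℝ :=
  ℓ * (μ * √c * (T * c * Real.exp (c * (H + T)) + reductionConst c b μ ℓ H T)) + 1

set_option maxHeartbeats 1000000 in
/-- Stability of a single mode `ẋ = A x + ∑ₖ Bₖ w(t - τₖ)`, `w = λ K x + d`, in coordinates in
which the Riccati solution is the identity. -/
theorem tendsto_zero_of_mode (A : E →L[ℂ] E) (B : Fin 3 → U →L[ℂ] E) (Bs : U →L[ℂ] E)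
    {τ : Fin 3 → ℝ} {γ c b μ ℓ H T : ℝ} {l : ℂ}
    (hτ0 : ∀ k, 0 ≤ τ k) (hτH : ∀ k, τ k ≤ H) (hT : 0 ≤ T) (hγ : 0 < γ) (hγ1 : γ ≤ 1)
    (hc : 1 ≤ c) (hμ : 0 < μ) (hl : 1 ≤ μ * l.re) (hlℓ : ‖l‖ ≤ ℓ)
    (hBs : Bs = ∑ k, NormedSpace.exp (-(τ k • A)) ∘L B k)
    (hric : ∀ y, 2 * (inner ℂ y (A y)).re = ‖Bs.adjoint y‖ ^ 2 - γ * ‖y‖ ^ 2)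
    (hBsn : ‖Bs‖ ^ 2 ≤ c * γ) (hB : ∀ k, ‖B k‖ ≤ b)
    (hsmall : (lyapunovConst c b μ ℓ H T + reductionConst c b μ ℓ H T) * √γ ≤ 1 / 2)
    (K : E →L[ℂ] U)
    (hK : ∀ x, K x = -((μ : ℂ) • Bs.adjoint (NormedSpace.exp (T • (A - Bs ∘L Bs.adjoint))
      (NormedSpace.exp (-(T • A)) x))))
    {x : ℝ → E} {d : ℝ → U} (hx : Continuous x) (hd : Continuous d)
    (hdlim : Tendsto d atTop (𝓝 0))
    (hode : ∀ t, 0 ≤ t → HasDerivWithinAt x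
      (A (x t) + ∑ k, B k (l • K (x (t - τ k)) + d (t - τ k))) (Set.Ici 0) t) :
    Tendsto x atTop (𝓝 0) := by
  have hH : 0 ≤ H := (hτ0 0).trans (hτH 0)
  have hb : 0 ≤ b := (norm_nonneg _).trans (hB 0)
  have hℓ : 0 ≤ ℓ := (norm_nonneg _).trans hlℓ
  set r := √γ with hr
  have hr0 : 0 < r := Real.sqrt_pos.2 hγ
  have hr1 : r ≤ 1 := Real.sqrt_le_one.2 hγ1
  have hrγ : r ^ 2 = γ := Real.sq_sqrt hγ.le
  set κ := √c with hκ
  have hκ0 : 0 ≤ κ := Real.sqrt_nonneg _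
  have hκc : κ ^ 2 = c := Real.sq_sqrt (by linarith)
  have hc0 : 0 ≤ c := by linarith
  have hBs' : ‖Bs‖ ≤ κ * r := by
    refine le_of_sq_le_sq ?_ (by positivity)
    rw [mul_pow, hκc, hrγ]; exact hBsn
  have hBa : ∀ y, ‖Bs.adjoint y‖ ≤ κ * r * ‖y‖ := fun y =>
    (Bs.adjoint.le_opNorm y).trans (by
      rw [LinearIsometryEquiv.norm_map]; gcongr)
  have hA : ∀ y, |(inner ℂ y (A y)).re| ≤ c * ‖y‖ ^ 2 := by
    intro y
    have h1 := hric y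
    have h2 : ‖Bs.adjoint y‖ ^ 2 ≤ c * γ * ‖y‖ ^ 2 := by
      have := pow_le_pow_left₀ (norm_nonneg _) (hBa y) 2
      rwa [mul_pow, mul_pow, hκc, hrγ] at this
    have h3 : 0 ≤ ‖Bs.adjoint y‖ ^ 2 := by positivity
    have h4 : γ * ‖y‖ ^ 2 ≤ 1 * ‖y‖ ^ 2 := by gcongr
    have h5 : 1 * ‖y‖ ^ 2 ≤ c * ‖y‖ ^ 2 := by gcongr
    have h6 : c * (γ * ‖y‖ ^ 2) ≤ c * (1 * ‖y‖ ^ 2) := by gcongr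
    have h7 : 0 ≤ γ * ‖y‖ ^ 2 := by positivity
    exact abs_le.2 ⟨by linarith, by linarith⟩
  have hG : ∀ y, (inner ℂ y ((A - Bs ∘L Bs.adjoint) y)).re ≤ 0 := by
    intro y
    have h1 : (inner ℂ y (Bs (Bs.adjoint y))).re = ‖Bs.adjoint y‖ ^ 2 := by
      rw [← ContinuousLinearMap.adjoint_inner_left, inner_self_eq_norm_sq_to_K]
      simp [← Complex.ofReal_pow]
    have h2 : 0 ≤ γ * ‖y‖ ^ 2 := by positivity
    simp only [_root_.sub_apply, ContinuousLinearMap.comp_apply, inner_sub_right, Complex.sub_re, h1]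
    nlinarith [hric y, sq_nonneg ‖Bs.adjoint y‖]
  set M := Real.exp (c * (H + T)) with hM
  have hM0 : 0 < M := Real.exp_pos _
  have hMT : Real.exp (c * T) ≤ M := Real.exp_le_exp.2 (by nlinarith)
  have hMτ : ∀ k, Real.exp (c * τ k) ≤ M := fun k =>
    Real.exp_le_exp.2 (by have := hτH k; gcongr; linarith)
  have hKn : ∀ z, ‖K z‖ ≤ μ * κ * M * (r * ‖z‖) := by
    intro z
    rw [hK, norm_neg, norm_smul, Complex.norm_real, Real.norm_of_nonneg hμ.le]
    have h1 := norm_exp_smul_apply_le _ (a := 0) (fun y => (hG y).trans_eq (zero_mul _).symm) hT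
      (NormedSpace.exp (-(T • A)) z)
    have h2 := norm_exp_smul_apply_le_abs A hA (-T) z
    rw [zero_mul, Real.exp_zero, one_mul] at h1
    rw [abs_neg, abs_of_nonneg hT, neg_smul] at h2
    calc _ ≤ μ * (κ * r * (M * ‖z‖)) := by
          refine mul_le_mul_of_nonneg_left ((hBa _).trans ?_) hμ.le
          refine mul_le_mul_of_nonneg_left (h1.trans (h2.trans ?_)) (by positivity)
          gcongr
      _ = _ := by ring
  set C₁ := reductionConst c b μ ℓ H T with hC₁
  set C₃ := lyapunovConst c b μ ℓ H T with hC₃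
  have hC₁0 : 0 ≤ C₁ := by rw [hC₁, reductionConst]; positivity
  have hC₃0 : 0 ≤ C₃ := by rw [hC₃, lyapunovConst, ← hC₁]; positivity
  let w : ℝ → U := fun s => l • K (x s) + d s
  have hw : Continuous w := ((K.continuous.comp hx).const_smul l).add hd
  -- The reduced state: its equation contains `w` undelayed, through `Bs` alone.
  let y : ℝ → E := fun t => x t + ∑ k, delayTerm A (B k) (τ k) w t
  have hyode : ∀ t, 0 ≤ t → HasDerivWithinAt y (A (y t) + Bs (w t)) (Set.Ici 0) t := by
    intro t ht
    have h1 := (hode t ht).add (HasDerivWithinAt.fun_sum (u := Finset.univ) fun k _ =>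
      (hasDerivAt_delayTerm A (B k) (τ k) hw t).hasDerivWithinAt (s := Set.Ici 0))
    refine h1.congr_deriv ?_
    simp only [y, w, hBs, Finset.sum_add_distrib, Finset.sum_sub_distrib, map_add, map_sum,
      _root_.sum_apply, ContinuousLinearMap.comp_apply]
    abel
  have hdiff : ∀ t X D, (∀ s ∈ Set.Icc (t - H) t, ‖x s‖ ≤ X) →
      (∀ s ∈ Set.Icc (t - H) t, ‖d s‖ ≤ D) → ‖x t - y t‖ ≤ C₁ * (r * X + D) := by
    intro t X D hX hD
    have hX0 : 0 ≤ X := (norm_nonneg _).trans (hX t ⟨by linarith, le_rfl⟩)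
    have hD0 : 0 ≤ D := (norm_nonneg _).trans (hD t ⟨by linarith, le_rfl⟩)
    have hW : ∀ s ∈ Set.Icc (t - H) t, ‖w s‖ ≤ (ℓ * (μ * κ * M) + 1) * (r * X + D) := by
      intro s hs
      have h1 : ‖w s‖ ≤ ℓ * (μ * κ * M * (r * X)) + D := by
        refine (norm_add_le _ _).trans (add_le_add ?_ (hD s hs))
        rw [norm_smul]
        have := hX s hs
        exact mul_le_mul hlℓ ((hKn _).trans (by gcongr)) (norm_nonneg _) hℓ
      refine h1.trans ?_
      have e1 : 0 ≤ ℓ * (μ * κ * M) * D := by positivity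
      have e2 : 0 ≤ r * X := by positivity
      nlinarith
    have hk : ∀ k, ‖delayTerm A (B k) (τ k) w t‖
        ≤ H * (M * b) * ((ℓ * (μ * κ * M) + 1) * (r * X + D)) := by
      intro k
      have := norm_delayTerm_le A (B k) (hτ0 k) hc0 hA (hB k) (w := w) (t := t)
        (fun s hs => hW s ⟨by linarith [hs.1, hτH k], hs.2⟩)
      refine this.trans ?_
      have h1 := hτH k
      have h2 := hMτ k
      gcongr
    have h3 : x t - y t = -∑ k, delayTerm A (B k) (τ k) w t := by simp [y]
    rw [h3, norm_neg]
    refine (norm_sum_le_of_le _ fun k _ => hk k).trans (le_of_eq ?_)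
    simp only [Finset.sum_const, Finset.card_univ, Fintype.card_fin, nsmul_eq_mul, hC₁,
      reductionConst, ← hM, ← hκ]
    push_cast; ring
  -- The deviation of the actual feedback from the ideal `-μ B* y`. It equals `-μ B*` applied to the
  -- predictor error plus the reduction error `x - y`.
  let δ : ℝ → U := fun t => K (x t) + (μ : ℂ) • Bs.adjoint (y t)
  have hδ : ∀ t X D, (∀ s ∈ Set.Icc (t - H) t, ‖x s‖ ≤ X) →
      (∀ s ∈ Set.Icc (t - H) t, ‖d s‖ ≤ D) → ‖l • δ t + d t‖ ≤ C₃ * (r ^ 2 * X + D) := by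
    intro t X D hX hD
    have hXt := hX t ⟨by linarith, le_rfl⟩
    have hDt := hD t ⟨by linarith, le_rfl⟩
    have hX0 : 0 ≤ X := (norm_nonneg _).trans hXt
    have hD0 : 0 ≤ D := (norm_nonneg _).trans hDt
    have h1 := norm_predictor_sub_le A Bs hT hc0 hA hG (x t)
    set p := NormedSpace.exp (T • (A - Bs ∘L Bs.adjoint)) (NormedSpace.exp (-(T • A)) (x t)) with hp
    have h2 : δ t = -((μ : ℂ) • Bs.adjoint ((p - x t) + (x t - y t))) := by
      simp only [δ, hK, ← hp]
      rw [sub_add_sub_cancel, map_sub, smul_sub]; abel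
    have h3 : ‖(p - x t) + (x t - y t)‖ ≤ T * c * M * (r ^ 2 * X) + C₁ * (r * X + D) := by
      refine (norm_add_le _ _).trans (add_le_add (h1.trans ?_) (hdiff t X D hX hD))
      have : T * (‖Bs‖ ^ 2 * Real.exp (c * T)) * ‖x t‖ ≤ T * (c * γ * M) * X := by gcongr
      refine this.trans (le_of_eq ?_)
      rw [← hrγ]; ring
    have h4 : ‖δ t‖ ≤ μ * (κ * r * (T * c * M * (r ^ 2 * X) + C₁ * (r * X + D))) := by
      rw [h2, norm_neg, norm_smul, Complex.norm_real, Real.norm_of_nonneg hμ.le]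
      refine mul_le_mul_of_nonneg_left ((hBa _).trans ?_) hμ.le
      gcongr
    have h5 : r * (T * c * M * (r ^ 2 * X) + C₁ * (r * X + D))
        ≤ (T * c * M + C₁) * (r ^ 2 * X + D) := by
      have e1 : r * (r ^ 2 * X) ≤ 1 * (r ^ 2 * X) := by gcongr
      have e2 : r * D ≤ 1 * D := by gcongr
      have e3 := mul_le_mul_of_nonneg_left e1 (show 0 ≤ T * c * M by positivity)
      have e4 := mul_le_mul_of_nonneg_left e2 hC₁0
      have e5 : 0 ≤ T * c * M * D := by positivity
      nlinarith
    have h6 : ‖δ t‖ ≤ μ * κ * ((T * c * M + C₁) * (r ^ 2 * X + D)) := by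
      refine h4.trans (le_trans (le_of_eq ?_) (mul_le_mul_of_nonneg_left h5 (by positivity)))
      ring
    have h7 : ‖l • δ t + d t‖ ≤ ℓ * (μ * κ * ((T * c * M + C₁) * (r ^ 2 * X + D))) + D := by
      refine (norm_add_le _ _).trans (add_le_add ?_ hDt)
      rw [norm_smul]
      exact mul_le_mul hlℓ h6 (norm_nonneg _) hℓ
    refine h7.trans ?_
    rw [hC₃, lyapunovConst, ← hC₁, ← hM, ← hκ]
    have e1 : 0 ≤ r ^ 2 * X := by positivity
    nlinarith
  have hest : ∀ t₀, 0 ≤ t₀ → ∀ t, t₀ ≤ t → ∀ X D, (∀ s ∈ Set.Icc (t₀ - H) t, ‖x s‖ ≤ X) →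
      (∀ s ∈ Set.Icc (t₀ - H) t, ‖d s‖ ≤ D) →
      ‖x t‖ ≤ Real.exp (-(γ / 2) * (t - t₀)) * ‖y t₀‖ + X / 2 + (C₃ / r + C₁) * D := by
    intro t₀ ht₀ t ht X D hX hD
    have hX0 : 0 ≤ X := (norm_nonneg _).trans (hX t ⟨by linarith, le_rfl⟩)
    have hD0 : 0 ≤ D := (norm_nonneg _).trans (hD t ⟨by linarith, le_rfl⟩)
    have hV := le_exp_mul_add_of_deriv_le (V := fun s => ‖y s‖ ^ 2)
      (V' := fun s => 2 * (inner ℂ (y s) (A (y s) + Bs (w s))).re)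
      (c := (C₃ * (r ^ 2 * X + D)) ^ 2) hγ (by positivity) ht
      (fun s hs => hasDerivWithinAt_norm_sq
        ((hyode s (ht₀.trans hs.1)).mono fun q hq => ht₀.trans hq.1))
      (fun s hs => by
        have hwδ : w s = -((l * μ) • Bs.adjoint (y s)) + (l • δ s + d s) := by
          simp only [w, δ, smul_add, smul_smul]; abel
        have h1 := lyapunov_derivative_le A Bs hl (hric (y s)) (l • δ s + d s)
        rw [← hwδ] at h1
        refine h1.trans (by
          gcongr
          exact hδ s X D (fun q hq => hX q ⟨by linarith [hq.1, hs.1], hq.2.trans hs.2⟩)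
            (fun q hq => hD q ⟨by linarith [hq.1, hs.1], hq.2.trans hs.2⟩)))
    have hexp : Real.exp (-γ * (t - t₀)) = Real.exp (-(γ / 2) * (t - t₀)) ^ 2 := by
      rw [← Real.exp_nat_mul]; congr 1; push_cast; ring
    have hy : ‖y t‖ ≤ Real.exp (-(γ / 2) * (t - t₀)) * ‖y t₀‖ + C₃ * (r * X + D / r) := by
      refine le_of_sq_le_sq ?_ (by positivity)
      -- The decay rate `γ = r²` costs one factor `r` after the square root. The error is of order
      -- `r²` in `X`, so a gain of order `r` survives.
      have e1 : (C₃ * (r ^ 2 * X + D)) ^ 2 / γ = (C₃ * (r * X + D / r)) ^ 2 := by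
        rw [← hrγ]; field_simp
      rw [hexp, e1] at hV
      have e2 : 0 ≤ Real.exp (-(γ / 2) * (t - t₀)) * ‖y t₀‖ * (C₃ * (r * X + D / r)) := by
        positivity
      refine hV.trans ?_
      nlinarith
    have hxy := hdiff t X D (fun q hq => hX q ⟨by linarith [hq.1], hq.2⟩)
      (fun q hq => hD q ⟨by linarith [hq.1], hq.2⟩)
    have h1 : ‖x t‖ ≤ ‖y t‖ + ‖x t - y t‖ := by
      calc ‖x t‖ = ‖y t + (x t - y t)‖ := by simp
        _ ≤ _ := norm_add_le _ _
    have h2 := mul_le_mul_of_nonneg_right hsmall hX0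
    have h3 : C₃ * (r * X + D / r) + C₁ * (r * X + D)
        = (C₃ + C₁) * r * X + (C₃ / r + C₁) * D := by
      field_simp; ring
    linarith
  rw [tendsto_zero_iff_norm_tendsto_zero]
  exact tendsto_zero_of_small_gain (c := fun t => ‖y t‖) (d := fun t => ‖d t‖) hx.norm
    (fun t => norm_nonneg _) hd.norm (tendsto_zero_iff_norm_tendsto_zero.1 hdlim)
    (half_pos hγ) (C := C₃ / r + C₁) (by positivity) hest

end Stability

/-! ### Spectrum of the Laplacian of a graph with a spanning tree -/

section Laplacian

namespace WeightedDigraph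

variable {N : ℕ} (G : WeightedDigraph N)

lemma laplacian_mulVec (v : Fin N → ℝ) (i : Fin N) :
    (G.laplacian *ᵥ v) i = ∑ j, G.weight i j * (v i - v j) := by
  rw [laplacian, Matrix.sub_mulVec, Pi.sub_apply, Matrix.mulVec_diagonal]
  simp only [Matrix.mulVec, dotProduct, mul_sub, Finset.sum_sub_distrib, Finset.sum_mul]

lemma laplacian_mulVec_neg (v : Fin N → ℝ) : G.laplacian *ᵥ (-v) = -(G.laplacian *ᵥ v) :=
  Matrix.mulVec_neg _ _

/-- The maximum principle: a vector in the kernel of the Laplacian attains its maximum at the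
root of every directed spanning tree. -/
lemma le_root_of_laplacian_mulVec_eq_zero {T : Fin N → Fin N → Prop} {r : Fin N}
    (hT : IsDirectedTree T r) (hTG : ∀ j i, T j i → G.Edge j i) {v : Fin N → ℝ}
    (hv : G.laplacian *ᵥ v = 0) (i : Fin N) : v i ≤ v r := by
  obtain ⟨q, -, hq⟩ := Finset.exists_max_image Finset.univ v ⟨r, Finset.mem_univ r⟩
  have key : v r = v q := by
    have hpath := hT.path q
    -- The maximum propagates from the maximizer `q` back to the root. At a maximal node the row sum
    -- has nonnegative terms and vanishes, so the parent, whose weight is nonzero, is maximal as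
    -- well.
    refine Relation.ReflTransGen.head_induction_on hpath rfl ?_
    intro a b hab _ hb
    have h1 := congrFun hv b
    rw [laplacian_mulVec, Pi.zero_apply] at h1
    have h2 : ∀ j ∈ Finset.univ, 0 ≤ G.weight b j * (v b - v j) := fun j _ =>
      mul_nonneg (G.weight_nonneg b j) (by rw [hb]; linarith [hq j (Finset.mem_univ j)])
    have h3 := (Finset.sum_eq_zero_iff_of_nonneg h2).1 h1 a (Finset.mem_univ a)
    have h4 := (mul_eq_zero.1 h3).resolve_left (hTG a b hab)
    linarith
  rw [key]; exact hq i (Finset.mem_univ i)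

variable {G}

lemma eq_of_laplacian_mulVec_eq_zero (hG : G.HasDirectedSpanningTree) {v : Fin N → ℝ}
    (hv : G.laplacian *ᵥ v = 0) (i j : Fin N) : v i = v j := by
  obtain ⟨T, r, hT, hTG⟩ := hG
  have h1 := G.le_root_of_laplacian_mulVec_eq_zero hT hTG hv
  have h2 := G.le_root_of_laplacian_mulVec_eq_zero hT hTG
    (show G.laplacian *ᵥ (-v) = 0 by rw [laplacian_mulVec_neg, hv, neg_zero])
  simp only [Pi.neg_apply, neg_le_neg_iff] at h2
  linarith [h1 i, h1 j, h2 i, h2 j]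

/-- `L v` is constant because it lies in the kernel. That constant is nonnegative where `v` is
maximal and nonpositive where `v` is minimal. Hence `0` has no Jordan block of size two. -/
lemma laplacian_mulVec_eq_zero_of_sq (hG : G.HasDirectedSpanningTree) {v : Fin N → ℝ}
    (hv : G.laplacian *ᵥ (G.laplacian *ᵥ v) = 0) : G.laplacian *ᵥ v = 0 := by
  have hconst := eq_of_laplacian_mulVec_eq_zero hG hv
  funext i
  obtain ⟨p, -, hp⟩ := Finset.exists_max_image Finset.univ v ⟨i, Finset.mem_univ i⟩
  obtain ⟨q, -, hq⟩ := Finset.exists_min_image Finset.univ v ⟨i, Finset.mem_univ i⟩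
  refine le_antisymm ?_ ?_
  · rw [hconst i q, laplacian_mulVec]
    exact Finset.sum_nonpos fun j _ => mul_nonpos_of_nonneg_of_nonpos (G.weight_nonneg q j)
      (by linarith [hq j (Finset.mem_univ j)])
  · rw [hconst i p, laplacian_mulVec]
    exact Finset.sum_nonneg fun j _ => mul_nonneg (G.weight_nonneg p j)
      (by linarith [hp j (Finset.mem_univ j)])

lemma laplacian_mulVec_eq_zero_of_pow (hG : G.HasDirectedSpanningTree) (k : ℕ) {v : Fin N → ℝ}
    (hv : (G.laplacian ^ k) *ᵥ v = 0) : G.laplacian *ᵥ v = 0 := by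
  induction k with
  | zero => rw [pow_zero, Matrix.one_mulVec] at hv; rw [hv, Matrix.mulVec_zero]
  | succ k ih =>
    cases k with
    | zero => simpa using hv
    | succ k =>
      refine ih ?_
      rw [pow_succ', ← Matrix.mulVec_mulVec]
      refine laplacian_mulVec_eq_zero_of_sq hG ?_
      rw [Matrix.mulVec_mulVec, Matrix.mulVec_mulVec, mul_assoc, ← pow_succ', ← pow_succ']
      exact hv

/-- Algebraic multiplicity is the dimension of the generalized eigenspace, which is contained in the
line of constant vectors. -/
lemma rootMultiplicity_laplacian_le_one (hG : G.HasDirectedSpanningTree) :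
    G.laplacian.charpoly.rootMultiplicity 0 ≤ 1 := by
  have h1 := LinearMap.finrank_maxGenEigenspace_eq (Matrix.toLin' G.laplacian) 0
  rw [Matrix.charpoly_toLin'] at h1
  rw [← h1]
  have hle : Module.End.maxGenEigenspace (Matrix.toLin' G.laplacian) 0 ≤
      Submodule.span ℝ {fun _ : Fin N => (1 : ℝ)} := by
    intro v hv
    obtain ⟨k, hk⟩ := (Module.End.mem_maxGenEigenspace _ _ _).1 hv
    rw [zero_smul, sub_zero, ← Matrix.toLin'_pow, Matrix.toLin'_apply] at hk
    have hconst := eq_of_laplacian_mulVec_eq_zero hG (laplacian_mulVec_eq_zero_of_pow hG k hk)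
    obtain ⟨T, r, -⟩ := hG
    refine Submodule.mem_span_singleton.2 ⟨v r, ?_⟩
    funext i
    simpa using hconst r i
  exact (Submodule.finrank_mono hle).trans (by simpa using finrank_span_le_card (R := ℝ) {fun _ : Fin N => (1 : ℝ)})

/-- Gershgorin: each disc has its radius equal to its centre `c ≥ 0`, so `|l|² ≤ 2 c Re l`. The disc
meets the closed left half-plane only at `0`. -/
lemma eq_zero_or_re_pos_of_mem_eigenvalueMultiset {l : ℂ} (hl : l ∈ eigenvalueMultiset G.laplacian) :
    l = 0 ∨ 0 < l.re := by
  have hroot : (G.laplacian.map (algebraMap ℝ ℂ)).charpoly.IsRoot l := Polynomial.isRoot_of_mem_roots hl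
  rw [← Matrix.charpoly_toLin', ← Module.End.hasEigenvalue_iff_isRoot_charpoly] at hroot
  obtain ⟨k, hk⟩ := eigenvalue_mem_ball hroot
  have hdiag : G.laplacian k k = ∑ j, G.weight k j := by
    simp [laplacian, G.weight_self]
  have hsum : ∑ j ∈ Finset.univ.erase k, ‖G.laplacian.map (algebraMap ℝ ℂ) k j‖
      = ∑ j, G.weight k j := by
    rw [← Finset.add_sum_erase _ _ (Finset.mem_univ k), G.weight_self, zero_add]
    refine Finset.sum_congr rfl fun j hj => ?_
    have hjk : k ≠ j := (Finset.ne_of_mem_erase hj).symm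
    simp [laplacian, Matrix.diagonal_apply_ne _ hjk, abs_of_nonneg (G.weight_nonneg k j)]
  rw [hsum, Metric.mem_closedBall, dist_eq_norm, Matrix.map_apply, hdiag] at hk
  set c := ∑ j, G.weight k j with hc
  have hc0 : 0 ≤ c := Finset.sum_nonneg fun j _ => G.weight_nonneg k j
  have h2 : (l.re - c) ^ 2 + l.im ^ 2 ≤ c ^ 2 := by
    have := pow_le_pow_left₀ (norm_nonneg _) hk 2
    rw [← Complex.normSq_eq_norm_sq, Complex.normSq_apply] at this
    simp at this
    nlinarith
  by_contra! hne
  obtain ⟨h3, h4⟩ := hne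
  have h5 : -(2 * c * l.re) ≥ 0 := by nlinarith
  have h6 : l.re = 0 := by nlinarith
  have h7 : l.im = 0 := by nlinarith
  exact h3 (Complex.ext h6 h7)

/-- A zero in `Λ` would make the multiplicity of `0` at least two. Positivity of the real parts is
what turns `1 / l.re ≤ μ` into `1 ≤ μ * l.re`. -/
lemma re_pos_of_eigenvalueMultiset_eq (hG : G.HasDirectedSpanningTree) {Λ : Multiset ℂ}
    (hΛ : eigenvalueMultiset G.laplacian = 0 ::ₘ Λ) {l : ℂ} (hl : l ∈ Λ) : 0 < l.re := by
  refine (eq_zero_or_re_pos_of_mem_eigenvalueMultiset (G := G)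
    (by rw [hΛ]; exact Multiset.mem_cons_of_mem hl)).resolve_left ?_
  rintro rfl
  have h1 : 2 ≤ (eigenvalueMultiset G.laplacian).count 0 := by
    rw [hΛ, Multiset.count_cons_self]
    have := Multiset.count_pos.2 hl
    omega
  have h2 := rootMultiplicity_laplacian_le_one hG
  rw [Polynomial.eq_rootMultiplicity_map (algebraMap ℝ ℂ).injective, map_zero,
    ← Matrix.charpoly_map, ← Polynomial.count_roots] at h2
  rw [eigenvalueMultiset] at h1
  omega

end WeightedDigraph

lemma charpoly_eq_prod_eigenvalueMultiset {n : ℕ} (A : Matrix (Fin n) (Fin n) ℝ) :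
    (A.map (algebraMap ℝ ℂ)).charpoly
      = ((eigenvalueMultiset A).map fun l => Polynomial.X - Polynomial.C l).prod := by
  have := (IsAlgClosed.splits (A.map (algebraMap ℝ ℂ)).charpoly).eq_prod_roots
  rwa [(Matrix.charpoly_monic _).leadingCoeff, map_one, one_mul] at this

/-- If all eigenvalues of `L` but one are nonzero, the characteristic polynomial factors as
`X * p` with `p(0) ≠ 0`. -/
lemma exists_charpoly_eq_X_mul {n : ℕ} {L : Matrix (Fin n) (Fin n) ℝ} {Λ : Multiset ℂ}
    (hΛ : eigenvalueMultiset L = 0 ::ₘ Λ) (h0 : (0 : ℂ) ∉ Λ) :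
    ∃ p : Polynomial ℝ, L.charpoly = Polynomial.X * p ∧ p.eval 0 ≠ 0 := by
  have h1 := charpoly_eq_prod_eigenvalueMultiset L
  rw [hΛ, Multiset.map_cons, Multiset.prod_cons, map_zero, sub_zero] at h1
  have h2 : L.charpoly.coeff 0 = 0 := by
    have := congrArg (fun q => Polynomial.coeff q 0) h1
    simp only [Polynomial.mul_coeff_zero, Polynomial.coeff_X_zero, zero_mul] at this
    rw [Matrix.charpoly_map, Polynomial.coeff_map] at this
    simpa using this
  have h3 : L.charpoly = Polynomial.X * L.charpoly.divX := by
    have := Polynomial.divX_mul_X_add L.charpoly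
    rw [h2, map_zero, add_zero, mul_comm] at this
    exact this.symm
  refine ⟨L.charpoly.divX, h3, fun h => ?_⟩
  have h4 : L.charpoly.divX.map (algebraMap ℝ ℂ)
      = (Λ.map fun l => Polynomial.X - Polynomial.C l).prod := by
    refine mul_left_cancel₀ (Polynomial.X_ne_zero (R := ℂ)) ?_
    rw [← h1, Matrix.charpoly_map]
    conv_rhs => rw [h3]
    rw [Polynomial.map_mul, Polynomial.map_X]
  have h5 := congrArg (Polynomial.eval 0) h4
  rw [Polynomial.eval_zero_map, h, map_zero, Polynomial.eval_multiset_prod, eq_comm,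
    Multiset.prod_eq_zero_iff] at h5
  simp only [Multiset.map_map, Multiset.mem_map, Function.comp_apply, Polynomial.eval_sub,
    Polynomial.eval_X, Polynomial.eval_C, zero_sub, neg_eq_zero] at h5
  obtain ⟨l, hl, rfl⟩ := h5
  exact h0 hl

end Laplacian

/-! ### Polynomial growth of the exponential for imaginary spectrum -/

section Growth

variable {𝔸 : Type*} [NormedRing 𝔸] [NormedAlgebra ℂ 𝔸] [CompleteSpace 𝔸]

lemma abs_pow_le_one_add_abs_pow {i k : ℕ} (h : i ≤ k) (t : ℝ) : |t| ^ i ≤ 1 + |t| ^ k := by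
  rcases le_total |t| 1 with ht | ht
  · have := pow_le_one₀ (n := i) (abs_nonneg t) ht
    have : 0 ≤ |t| ^ k := by positivity
    linarith
  · have := pow_le_pow_right₀ ht h
    linarith

lemma exp_mul_eq_sum_of_pow_mul_eq_zero {a b : 𝔸} {m : ℕ} (h : a ^ m * b = 0) :
    NormedSpace.exp a * b = ∑ i ∈ Finset.range m, ((i.factorial : ℂ)⁻¹ • a ^ i) * b := by
  have h1 := (NormedSpace.exp_series_hasSum_exp' (𝕂 := ℂ) a).mul_right b
  refine h1.unique (hasSum_sum_of_ne_finset_zero fun i hi => ?_)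
  obtain ⟨j, rfl⟩ := Nat.exists_eq_add_of_le (not_lt.1 (Finset.mem_range.not.1 hi))
  rw [smul_mul_assoc, add_comm, pow_add, mul_assoc, h, mul_zero, smul_zero]

/-- On `b` the element `a - l` acts nilpotently, so `e^{ta} b` is `e^{tl}`, of modulus one, times a
polynomial in `t` of degree below `m`. -/
lemma norm_exp_smul_mul_le {a b : 𝔸} {l : ℂ} (hl : l.re = 0) {m k : ℕ} (hmk : m ≤ k)
    (h : (a - algebraMap ℂ 𝔸 l) ^ m * b = 0) :
    ∃ c, 0 ≤ c ∧ ∀ t : ℝ, ‖NormedSpace.exp (t • a) * b‖ ≤ c * (1 + |t| ^ (k - 1)) := by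
  set N := a - algebraMap ℂ 𝔸 l with hN
  have key : ∀ t : ℝ, NormedSpace.exp (t • a) * b = NormedSpace.exp ((t : ℂ) * l) •
      ∑ i ∈ Finset.range m, ((i.factorial : ℂ)⁻¹ * (t : ℂ) ^ i) • (N ^ i * b) := by
    intro t
    have h1 : t • a = algebraMap ℂ 𝔸 ((t : ℂ) * l) + (t : ℂ) • N := by
      rw [hN, map_mul, smul_sub, ← Algebra.smul_def, Complex.coe_smul t a]
      abel
    let _ : NormedAlgebra ℚ 𝔸 := NormedAlgebra.restrictScalars ℚ ℂ _
    rw [h1, NormedSpace.exp_add_of_commute (Algebra.commutes _ _), ← NormedSpace.algebraMap_exp_comm,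
      mul_assoc, ← Algebra.smul_def, exp_mul_eq_sum_of_pow_mul_eq_zero (m := m)]
    · congr 1
      refine Finset.sum_congr rfl fun i _ => ?_
      rw [smul_pow, smul_smul, smul_mul_assoc]
    · rw [smul_pow, smul_mul_assoc, h, smul_zero]
  refine ⟨∑ i ∈ Finset.range m, (i.factorial : ℝ)⁻¹ * ‖N ^ i * b‖, by positivity, fun t => ?_⟩
  rw [key, norm_smul]
  have h2 : ‖NormedSpace.exp ((t : ℂ) * l)‖ = 1 := by
    rw [← Complex.exp_eq_exp_ℂ, Complex.norm_exp]; simp [hl]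
  rw [h2, one_mul, Finset.sum_mul]
  refine norm_sum_le_of_le _ fun i hi => ?_
  rw [norm_smul, norm_mul, norm_inv, norm_pow, Complex.norm_real, Complex.norm_natCast,
    Real.norm_eq_abs]
  have h3 := abs_pow_le_one_add_abs_pow (i := i) (k := k - 1)
    (by have := Finset.mem_range.1 hi; omega) t
  calc _ = (i.factorial : ℝ)⁻¹ * ‖N ^ i * b‖ * |t| ^ i := by ring
    _ ≤ _ := by gcongr

/-- If `a` is annihilated by `∏ (X - l)^{m l}` with all `l` imaginary, then `e^{ta}` grows at most
like `|t|^{k-1}`, `k` the largest exponent. -/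
lemma exists_norm_exp_smul_le {a : 𝔸} {S : Finset ℂ} {m : ℂ → ℕ} {k : ℕ}
    (hS : ∀ l ∈ S, l.re = 0) (hm : ∀ l ∈ S, m l ≤ k)
    (ha : Polynomial.aeval a (∏ l ∈ S, (Polynomial.X - Polynomial.C l) ^ m l) = 0) :
    ∃ c, 0 ≤ c ∧ ∀ t : ℝ, ‖NormedSpace.exp (t • a)‖ ≤ c * (1 + |t| ^ (k - 1)) := by
  classical
  rcases S.eq_empty_or_nonempty with rfl | hne
  · refine ⟨0, le_rfl, fun t => ?_⟩
    rw [Finset.prod_empty, map_one] at ha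
    rw [← mul_one (NormedSpace.exp (t • a)), ha]; simp
  have hcop : Pairwise (Function.onFun IsCoprime fun i : S =>
      (Polynomial.X - Polynomial.C (i : ℂ)) ^ m i) := fun i j hij =>
    (Polynomial.pairwise_coprime_X_sub_C Subtype.val_injective hij).pow
  obtain ⟨q, hq⟩ := (exists_sum_eq_one_iff_pairwise_coprime
    (s := fun l => (Polynomial.X - Polynomial.C l) ^ m l) hne).2 hcop
  -- Bézout for the coprime primary factors: the `b i` sum to `1`, and each is annihilated by its
  -- own `(a - i)^{m i}`.
  let b : ℂ → 𝔸 := fun i =>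
    Polynomial.aeval a (q i * ∏ j ∈ S \ {i}, (Polynomial.X - Polynomial.C j) ^ m j)
  have hb : ∀ i ∈ S, (a - algebraMap ℂ 𝔸 i) ^ m i * b i = 0 := by
    intro i hi
    have h1 : (a - algebraMap ℂ 𝔸 i) ^ m i
        = Polynomial.aeval a ((Polynomial.X - Polynomial.C i) ^ m i) := by simp
    rw [h1, ← map_mul]
    have h2 : (Polynomial.X - Polynomial.C i) ^ m i *
        (q i * ∏ j ∈ S \ {i}, (Polynomial.X - Polynomial.C j) ^ m j)
        = q i * ∏ l ∈ S, (Polynomial.X - Polynomial.C l) ^ m l := by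
      rw [← Finset.mul_prod_erase S _ hi, Finset.sdiff_singleton_eq_erase]; ring
    rw [h2, map_mul, ha, mul_zero]
  have hsum : ∑ i ∈ S, b i = 1 := by
    simp only [b]; rw [← map_sum, hq, map_one]
  choose! c hc0 hc using fun i (hi : i ∈ S) => norm_exp_smul_mul_le (hS i hi) (hm i hi) (hb i hi)
  refine ⟨∑ i ∈ S, c i, Finset.sum_nonneg hc0, fun t => ?_⟩
  rw [← mul_one (NormedSpace.exp (t • a)), ← hsum, Finset.mul_sum, Finset.sum_mul]
  exact norm_sum_le_of_le _ fun i hi => hc i hi t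

end Growth

/-! ### Lyapunov equations for antistable matrices, and controllability -/

section Lyapunov

variable {n m : ℕ}

lemma exp_map_ofReal (A : Matrix (Fin n) (Fin n) ℝ) :
    NormedSpace.exp (A.map (algebraMap ℝ ℂ)) = (NormedSpace.exp A).map (algebraMap ℝ ℂ) := by
  let _ : NormedRing (Matrix (Fin n) (Fin n) ℂ) := Matrix.linftyOpNormedRing
  let _ : NormedRing (Matrix (Fin n) (Fin n) ℝ) := Matrix.linftyOpNormedRing
  let _ : NormedAlgebra ℝ (Matrix (Fin n) (Fin n) ℝ) := Matrix.linftyOpNormedAlgebra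
  let _ : NormedAlgebra ℚ (Matrix (Fin n) (Fin n) ℝ) := NormedAlgebra.restrictScalars ℚ ℝ _
  have : CompleteSpace (Matrix (Fin n) (Fin n) ℝ) := FiniteDimensional.complete ℝ _
  exact (NormedSpace.map_exp (algebraMap ℝ ℂ).mapMatrix
    (Continuous.matrix_map continuous_id Complex.continuous_ofReal) A).symm

lemma exists_norm_exp_smul_apply_le (A : Matrix (Fin n) (Fin n) ℝ)
    (himag : ∀ l ∈ eigenvalueMultiset A, l.re = 0) :
    ∃ c, 0 ≤ c ∧ ∀ (t : ℝ) i j,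
      ‖NormedSpace.exp (t • A.map (algebraMap ℝ ℂ)) i j‖
        ≤ c * (1 + |t| ^ (maxAlgMultiplicity A - 1)) := by
  let _ : NormedRing (Matrix (Fin n) (Fin n) ℂ) := Matrix.linftyOpNormedRing
  let _ : NormedAlgebra ℂ (Matrix (Fin n) (Fin n) ℂ) := Matrix.linftyOpNormedAlgebra
  obtain ⟨c, hc0, hc⟩ := exists_norm_exp_smul_le (a := A.map (algebraMap ℝ ℂ))
    (S := (eigenvalueMultiset A).toFinset) (m := fun l => (eigenvalueMultiset A).count l)
    (k := maxAlgMultiplicity A) (fun l hl => himag l (Multiset.mem_toFinset.1 hl))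
    (fun l hl => Finset.le_sup (f := fun l => (eigenvalueMultiset A).count l) hl) (by
      rw [← Finset.prod_multiset_map_count, ← charpoly_eq_prod_eigenvalueMultiset]
      exact Matrix.aeval_self_charpoly _)
  have hentry : ∀ (X : Matrix (Fin n) (Fin n) ℂ) i j, ‖X i j‖ ≤ ‖X‖ := by
    intro X i j
    rw [Matrix.linfty_opNorm_def]
    exact NNReal.coe_le_coe.2 ((Finset.single_le_sum (f := fun j => ‖X i j‖₊)
      (fun _ _ => zero_le) (Finset.mem_univ j)).trans
      (Finset.le_sup (f := fun i => ∑ j, ‖X i j‖₊) (Finset.mem_univ i)))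
  exact ⟨c, hc0, fun t i j => (hentry _ i j).trans (hc t)⟩

lemma exists_abs_exp_smul_apply_le (A : Matrix (Fin n) (Fin n) ℝ)
    (himag : ∀ l ∈ eigenvalueMultiset A, l.re = 0) :
    ∃ c, 0 ≤ c ∧ ∀ (t : ℝ) i j,
      |NormedSpace.exp (t • A) i j| ≤ c * (1 + |t| ^ (maxAlgMultiplicity A - 1)) := by
  obtain ⟨c, hc0, hc⟩ := exists_norm_exp_smul_apply_le A himag
  refine ⟨c, hc0, fun t i j => ?_⟩
  have h1 : t • A.map (algebraMap ℝ ℂ) = (t • A).map (algebraMap ℝ ℂ) := by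
    ext i j; simp
  have h2 := hc t i j
  rw [h1, exp_map_ofReal] at h2
  simpa using h2

/-- `e^{-t(A + γ/2)} = e^{-γt/2} e^{-tA}`, and the decaying factor beats the polynomial growth. Thus
`A + γ/2` is antistable. -/
lemma tendsto_exp_shift_zero (A : Matrix (Fin n) (Fin n) ℝ)
    (himag : ∀ l ∈ eigenvalueMultiset A, l.re = 0) {γ : ℝ} (hγ : 0 < γ) :
    Tendsto (fun t : ℝ => NormedSpace.exp (t • -(A + (γ / 2) • 1))) atTop (𝓝 0) := by
  obtain ⟨c, hc0, hc⟩ := exists_abs_exp_smul_apply_le A himag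
  refine tendsto_pi_nhds.2 fun i => tendsto_pi_nhds.2 fun j => ?_
  have key : ∀ t : ℝ, NormedSpace.exp (t • -(A + (γ / 2) • 1))
      = Real.exp (-(γ / 2) * t) • NormedSpace.exp ((-t) • A) := by
    intro t
    have h1 : t • -(A + (γ / 2) • (1 : Matrix (Fin n) (Fin n) ℝ))
        = Matrix.diagonal (fun _ => -(γ / 2) * t) + (-t) • A := by
      ext i j
      by_cases hij : i = j
      · subst hij; simp; ring
      · simp [hij]
    rw [h1, Matrix.exp_add_of_commute, Matrix.exp_diagonal]
    · have : NormedSpace.exp (fun _ : Fin n => -(γ / 2) * t) = fun _ => Real.exp (-(γ / 2) * t) := by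
        rw [Pi.exp_def, Real.exp_eq_exp_ℝ]
      rw [this]
      ext i j; simp
    · rw [← Matrix.smul_one_eq_diagonal]
      exact (Commute.one_left _).smul_left _
  have hlim : Tendsto (fun t : ℝ => c * ((1 + t ^ (maxAlgMultiplicity A - 1)) *
      Real.exp (-(γ / 2) * t))) atTop (𝓝 0) := by
    have h1 : ∀ k : ℕ, Tendsto (fun t : ℝ => t ^ k * Real.exp (-(γ / 2) * t)) atTop (𝓝 0) := by
      intro k
      have := (isLittleO_pow_exp_pos_mul_atTop k (half_pos hγ)).tendsto_div_nhds_zero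
      refine this.congr fun t => ?_
      rw [neg_mul, Real.exp_neg, div_eq_mul_inv]
    have := ((h1 0).add (h1 (maxAlgMultiplicity A - 1))).const_mul c
    rw [add_zero, mul_zero] at this
    refine this.congr fun t => ?_
    ring
  refine squeeze_zero_norm' ?_ hlim
  filter_upwards [eventually_ge_atTop 0] with t ht
  rw [key, Matrix.smul_apply, norm_smul, Real.norm_eq_abs, Real.norm_eq_abs, Real.abs_exp]
  have := hc (-t) i j
  rw [abs_neg, abs_of_nonneg ht] at this
  calc _ ≤ Real.exp (-(γ / 2) * t) * (c * (1 + t ^ (maxAlgMultiplicity A - 1))) := by gcongr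
    _ = _ := by ring

/-- The flow of the Lyapunov equation. -/
def lyapunovFlow (M W : Matrix (Fin n) (Fin n) ℝ) (t : ℝ) : Matrix (Fin n) (Fin n) ℝ :=
  NormedSpace.exp (t • -M) * W * NormedSpace.exp (t • -Mᵀ)

lemma lyapunovFlow_zero (M W : Matrix (Fin n) (Fin n) ℝ) : lyapunovFlow M W 0 = W := by
  simp [lyapunovFlow]

lemma exp_smul_neg_transpose (M : Matrix (Fin n) (Fin n) ℝ) (t : ℝ) :
    NormedSpace.exp (t • -Mᵀ) = (NormedSpace.exp (t • -M))ᵀ := by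
  rw [← Matrix.exp_transpose, Matrix.transpose_smul, Matrix.transpose_neg]

lemma tendsto_lyapunovFlow {M : Matrix (Fin n) (Fin n) ℝ}
    (hM : Tendsto (fun t : ℝ => NormedSpace.exp (t • -M)) atTop (𝓝 0))
    (W : Matrix (Fin n) (Fin n) ℝ) : Tendsto (lyapunovFlow M W) atTop (𝓝 0) := by
  have hT : Tendsto (fun t : ℝ => NormedSpace.exp (t • -Mᵀ)) atTop (𝓝 0) := by
    simp only [exp_smul_neg_transpose]
    have := (continuous_id.matrix_transpose (A := id)).continuousAt (x := (0 : Matrix (Fin n) (Fin n) ℝ)).tendsto.comp hM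
    simpa [Function.comp_def] using this
  have := (hM.mul_const W).mul hT
  rw [zero_mul, zero_mul] at this
  exact this

/-- `M` commutes with its exponentials, so differentiating the flow of `W` yields minus the flow of
the Lyapunov operator at `W`. The rest of the Lyapunov theory follows from this and from the limit
`0` at infinity. -/
lemma hasDerivAt_lyapunovFlow (M W : Matrix (Fin n) (Fin n) ℝ) (v w : Fin n → ℝ) (t : ℝ) :
    HasDerivAt (fun t => v ⬝ᵥ lyapunovFlow M W t *ᵥ w)
      (-(v ⬝ᵥ lyapunovFlow M (M * W + W * Mᵀ) t *ᵥ w)) t := by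
  let _ : NormedRing (Matrix (Fin n) (Fin n) ℝ) := Matrix.linftyOpNormedRing
  let _ : NormedAlgebra ℝ (Matrix (Fin n) (Fin n) ℝ) := Matrix.linftyOpNormedAlgebra
  have h1 : HasDerivAt (lyapunovFlow M W) (-(lyapunovFlow M (M * W + W * Mᵀ) t)) t := by
    refine (((hasDerivAt_exp_smul_const (𝕂 := ℝ) (-M) t).mul_const W).mul
      (hasDerivAt_exp_smul_const' (𝕂 := ℝ) (-Mᵀ) t)).congr_deriv ?_
    simp only [lyapunovFlow]
    noncomm_ring
  let f : Matrix (Fin n) (Fin n) ℝ →ₗ[ℝ] ℝ :=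
    { toFun := fun X => v ⬝ᵥ X *ᵥ w
      map_add' := fun X Y => by rw [Matrix.add_mulVec, dotProduct_add]
      map_smul' := fun r X => by rw [Matrix.smul_mulVec, dotProduct_smul]; rfl }
  have h2 := (LinearMap.toContinuousLinearMap f).hasFDerivAt.comp_hasDerivAt t h1
  refine h2.congr_deriv ?_
  change v ⬝ᵥ (-_) *ᵥ w = _
  rw [Matrix.neg_mulVec, dotProduct_neg]

lemma tendsto_dotProduct_lyapunovFlow {M : Matrix (Fin n) (Fin n) ℝ}
    (hM : Tendsto (fun t : ℝ => NormedSpace.exp (t • -M)) atTop (𝓝 0))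
    (W : Matrix (Fin n) (Fin n) ℝ) (v w : Fin n → ℝ) :
    Tendsto (fun t => v ⬝ᵥ lyapunovFlow M W t *ᵥ w) atTop (𝓝 0) := by
  have hcont : Continuous fun X : Matrix (Fin n) (Fin n) ℝ => v ⬝ᵥ X *ᵥ w := by fun_prop
  simpa [Function.comp_def] using
    (hcont.continuousAt (x := 0)).tendsto.comp (tendsto_lyapunovFlow hM W)

/-- The Lyapunov operator of an antistable matrix reflects positivity. -/
lemma dotProduct_mulVec_nonneg_of_lyapunov {M W : Matrix (Fin n) (Fin n) ℝ}
    (hM : Tendsto (fun t : ℝ => NormedSpace.exp (t • -M)) atTop (𝓝 0))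
    (h : ∀ v, 0 ≤ v ⬝ᵥ (M * W + W * Mᵀ) *ᵥ v) (v : Fin n → ℝ) : 0 ≤ v ⬝ᵥ W *ᵥ v := by
  have hanti : Antitone fun t => v ⬝ᵥ lyapunovFlow M W t *ᵥ v := by
    refine antitone_of_deriv_nonpos
      (fun t => (hasDerivAt_lyapunovFlow M W v v t).differentiableAt) fun t => ?_
    rw [(hasDerivAt_lyapunovFlow M W v v t).deriv, neg_nonpos]
    have := h (NormedSpace.exp (t • -Mᵀ) *ᵥ v)
    rw [lyapunovFlow, ← Matrix.mulVec_mulVec, ← Matrix.mulVec_mulVec, Matrix.dotProduct_mulVec,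
      ← Matrix.mulVec_transpose, ← exp_smul_neg_transpose]
    exact this
  have := hanti.le_of_tendsto (tendsto_dotProduct_lyapunovFlow hM W v v) 0
  rwa [lyapunovFlow_zero] at this

lemma eq_zero_of_lyapunov_eq_zero {M W : Matrix (Fin n) (Fin n) ℝ}
    (hM : Tendsto (fun t : ℝ => NormedSpace.exp (t • -M)) atTop (𝓝 0))
    (h : M * W + W * Mᵀ = 0) : W = 0 := by
  have hz : ∀ v w : Fin n → ℝ, v ⬝ᵥ W *ᵥ w = 0 := by
    intro v w
    have hconst : ∀ t, v ⬝ᵥ lyapunovFlow M W t *ᵥ w = v ⬝ᵥ lyapunovFlow M W 0 *ᵥ w := fun t =>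
      is_const_of_deriv_eq_zero
        (fun t => (hasDerivAt_lyapunovFlow M W v w t).differentiableAt) (fun t => by
          rw [(hasDerivAt_lyapunovFlow M W v w t).deriv, h]; simp [lyapunovFlow]) t 0
    have h1 := tendsto_dotProduct_lyapunovFlow hM W v w
    simp only [hconst, lyapunovFlow_zero] at h1
    exact tendsto_nhds_unique tendsto_const_nhds h1
  ext i j
  simpa using hz (Pi.single i 1) (Pi.single j 1)

/-- An injective linear endomorphism of the finite-dimensional matrix space is surjective, so no
integral formula is needed. -/
lemma exists_lyapunov_eq {M : Matrix (Fin n) (Fin n) ℝ}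
    (hM : Tendsto (fun t : ℝ => NormedSpace.exp (t • -M)) atTop (𝓝 0))
    (Q : Matrix (Fin n) (Fin n) ℝ) : ∃ W, M * W + W * Mᵀ = Q := by
  let f : Matrix (Fin n) (Fin n) ℝ →ₗ[ℝ] Matrix (Fin n) (Fin n) ℝ :=
    LinearMap.mulLeft ℝ M + LinearMap.mulRight ℝ Mᵀ
  have hf : Function.Injective f := by
    rw [← LinearMap.ker_eq_bot, LinearMap.ker_eq_bot']
    exact fun W hW => eq_zero_of_lyapunov_eq_zero hM (by simpa [f] using hW)
  obtain ⟨W, hW⟩ := LinearMap.injective_iff_surjective.1 hf Q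
  exact ⟨W, by simpa [f] using hW⟩

lemma IsControllable.eq_zero {A : Matrix (Fin n) (Fin n) ℝ} {B : Matrix (Fin n) (Fin m) ℝ}
    (h : IsControllable A B) {v : Fin n → ℝ} (hv : ∀ k : ℕ, Bᵀ *ᵥ ((Aᵀ) ^ k *ᵥ v) = 0) : v = 0 := by
  have h1 : (controllabilityMatrix A B)ᵀ.rank = n := by rw [Matrix.rank_transpose]; exact h
  have h2 := LinearMap.finrank_range_add_finrank_ker (controllabilityMatrix A B)ᵀ.mulVecLin
  rw [← Matrix.rank, h1, Module.finrank_fin_fun, Nat.add_eq_left] at h2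
  have h3 := Submodule.finrank_eq_zero.1 h2
  rw [LinearMap.ker_eq_bot'] at h3
  refine h3 v ?_
  funext p
  have h4 := congrFun (hv (p.1 : ℕ)) p.2
  rw [Matrix.mulVec_mulVec, ← Matrix.transpose_pow, ← Matrix.transpose_mul] at h4
  exact h4

end Lyapunov

/-! ### The parametric Riccati equation -/

section Riccati

variable {n m : ℕ} {A : Matrix (Fin n) (Fin n) ℝ} {B : Matrix (Fin n) (Fin m) ℝ} {γ : ℝ}

lemma shifted_lyapunov (A W : Matrix (Fin n) (Fin n) ℝ) (γ : ℝ) :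
    (A + (γ / 2) • 1) * W + W * (A + (γ / 2) • 1)ᵀ = A * W + W * Aᵀ + γ • W := by
  simp only [Matrix.transpose_add, Matrix.transpose_smul, Matrix.transpose_one, add_mul, mul_add,
    Matrix.smul_mul, Matrix.mul_smul, one_mul, mul_one]
  have : γ • W = (γ / 2) • W + (γ / 2) • W := by rw [← add_smul, add_halves]
  rw [this]; abel

lemma IsPosDefRiccatiSolution.lyapunov {P : Matrix (Fin n) (Fin n) ℝ}
    (h : IsPosDefRiccatiSolution A B γ P) : A * P⁻¹ + P⁻¹ * Aᵀ + γ • P⁻¹ = B * Bᵀ := by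
  have hu := (Matrix.isUnit_iff_isUnit_det _).1 h.posDef.isUnit
  have h1 := congrArg (fun X => P⁻¹ * X * P⁻¹) h.riccati
  simp only [mul_sub, mul_add, sub_mul, add_mul, mul_neg, neg_mul, Matrix.mul_smul,
    Matrix.smul_mul] at h1
  have e1 : P⁻¹ * (Aᵀ * P) * P⁻¹ = P⁻¹ * Aᵀ := by
    rw [mul_assoc, mul_assoc, Matrix.mul_nonsing_inv _ hu, mul_one]
  have e2 : P⁻¹ * (P * A) * P⁻¹ = A * P⁻¹ := by
    rw [← mul_assoc, Matrix.nonsing_inv_mul _ hu, one_mul]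
  have e3 : P⁻¹ * (P * B * Bᵀ * P) * P⁻¹ = B * Bᵀ := by
    rw [mul_assoc P⁻¹, mul_assoc _ P, Matrix.mul_nonsing_inv _ hu, mul_one, Matrix.mul_assoc P,
      ← mul_assoc, Matrix.nonsing_inv_mul _ hu, one_mul]
  have e4 : P⁻¹ * P * P⁻¹ = P⁻¹ := by rw [Matrix.nonsing_inv_mul _ hu, one_mul]
  rw [e1, e2, e3, e4] at h1
  rw [← sub_eq_zero] at h1 ⊢
  rw [← h1]; abel

/-- `P ↦ P⁻¹` reduces the equation to a uniquely solvable Lyapunov equation. Its solution `W` is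
symmetric by uniqueness and nonnegative because `B Bᵀ` is. The kernel of `W` is `Aᵀ`-invariant and
contained in that of `Bᵀ`, hence zero by controllability. -/
theorem exists_unique_riccati (hctrl : IsControllable A B)
    (himag : ∀ l ∈ eigenvalueMultiset A, l.re = 0) (hγ : 0 < γ) :
    ∃ P, IsPosDefRiccatiSolution A B γ P ∧ ∀ Q, IsPosDefRiccatiSolution A B γ Q → Q = P := by
  have hM := tendsto_exp_shift_zero A himag hγ
  obtain ⟨W, hW⟩ := exists_lyapunov_eq hM (B * Bᵀ)
  have huniq : ∀ V, (A + (γ / 2) • 1) * V + V * (A + (γ / 2) • 1)ᵀ = B * Bᵀ → V = W := by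
    intro V hV
    refine sub_eq_zero.1 (eq_zero_of_lyapunov_eq_zero hM ?_)
    rw [mul_sub, sub_mul, sub_add_sub_comm, hV, hW, sub_self]
  have hsymm : Wᵀ = W := huniq _ (by
    have := congrArg Matrix.transpose hW
    rw [Matrix.transpose_add, Matrix.transpose_mul, Matrix.transpose_mul, Matrix.transpose_transpose,
      Matrix.transpose_mul, Matrix.transpose_transpose, add_comm] at this
    exact this)
  have hBB : ∀ v : Fin n → ℝ, v ⬝ᵥ (B * Bᵀ) *ᵥ v = (Bᵀ *ᵥ v) ⬝ᵥ (Bᵀ *ᵥ v) := fun v => by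
    rw [← Matrix.mulVec_mulVec, Matrix.dotProduct_mulVec, ← Matrix.mulVec_transpose]
  have hpsd : W.PosSemidef := Matrix.PosSemidef.of_dotProduct_mulVec_nonneg
    (by rw [Matrix.IsHermitian, Matrix.conjTranspose_eq_transpose_of_trivial, hsymm])
    (fun v => by
      rw [star_trivial]
      refine dotProduct_mulVec_nonneg_of_lyapunov hM (fun v => ?_) v
      rw [hW, hBB]
      exact Finset.sum_nonneg fun i _ => mul_self_nonneg _)
  rw [shifted_lyapunov] at hW
  have hker : ∀ v, W *ᵥ v = 0 → Bᵀ *ᵥ v = 0 ∧ W *ᵥ (Aᵀ *ᵥ v) = 0 := by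
    intro v hv
    have h1 : (B * Bᵀ) *ᵥ v = W *ᵥ (Aᵀ *ᵥ v) := by
      rw [← hW, Matrix.add_mulVec, Matrix.add_mulVec, ← Matrix.mulVec_mulVec, hv,
        Matrix.smul_mulVec, hv, Matrix.mulVec_zero, smul_zero, zero_add, add_zero,
        Matrix.mulVec_mulVec]
    have h2 : v ⬝ᵥ (B * Bᵀ) *ᵥ v = 0 := by
      rw [h1, Matrix.dotProduct_mulVec, ← Matrix.mulVec_transpose, hsymm, hv, zero_dotProduct]
    rw [hBB] at h2
    have h3 := dotProduct_self_eq_zero.1 h2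
    refine ⟨h3, ?_⟩
    rw [← h1, ← Matrix.mulVec_mulVec, h3, Matrix.mulVec_zero]
  have hpd : W.PosDef := Matrix.PosDef.of_dotProduct_mulVec_pos hpsd.isHermitian fun v hv => by
    refine lt_of_le_of_ne (hpsd.dotProduct_mulVec_nonneg v) fun h0 => hv ?_
    have h1 := (hpsd.dotProduct_mulVec_zero_iff v).1 h0.symm
    have h2 : ∀ k : ℕ, W *ᵥ ((Aᵀ) ^ k *ᵥ v) = 0 := by
      intro k
      induction k with
      | zero => simpa using h1
      | succ k ih =>
        rw [pow_succ', ← Matrix.mulVec_mulVec]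
        exact (hker _ ih).2
    exact hctrl.eq_zero fun k => (hker _ (h2 k)).1
  have hu := (Matrix.isUnit_iff_isUnit_det _).1 hpd.isUnit
  refine ⟨W⁻¹, ⟨hpd.inv, ?_⟩, fun Q hQ => ?_⟩
  · have h1 : W⁻¹ * B * Bᵀ * W⁻¹ = W⁻¹ * A + Aᵀ * W⁻¹ + γ • W⁻¹ := by
      rw [Matrix.mul_assoc W⁻¹, ← hW]
      simp only [mul_add, add_mul, Matrix.mul_smul, Matrix.smul_mul]
      rw [Matrix.nonsing_inv_mul _ hu, one_mul, ← mul_assoc W⁻¹ A, mul_assoc _ W,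
        Matrix.mul_nonsing_inv _ hu, mul_one, ← mul_assoc W⁻¹ W, Matrix.nonsing_inv_mul _ hu, one_mul]
    rw [h1]; abel
  · have h1 := huniq Q⁻¹ (by rw [shifted_lyapunov]; exact hQ.lyapunov)
    rw [← h1, Matrix.nonsing_inv_nonsing_inv _ ((Matrix.isUnit_iff_isUnit_det _).1 hQ.posDef.isUnit)]

lemma trace_eq_zero_of_imaginary (himag : ∀ l ∈ eigenvalueMultiset A, l.re = 0) : A.trace = 0 := by
  have h1 := Matrix.trace_eq_sum_roots_charpoly (A.map (algebraMap ℝ ℂ))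
  have h2 : (A.map (algebraMap ℝ ℂ)).trace = ((A.trace : ℝ) : ℂ) := by
    simp [Matrix.trace]
  rw [h2] at h1
  have h3 := congrArg Complex.reAddGroupHom h1
  rw [map_multiset_sum, Multiset.sum_eq_zero] at h3
  · simpa using h3
  · intro r hr
    obtain ⟨l, hl, rfl⟩ := Multiset.mem_map.1 hr
    exact himag l hl

/-- Multiply the Lyapunov equation for `P⁻¹` by `P` and take traces: the result is `2 tr A + n γ`,
and `tr A` vanishes. This is the source of `‖B‖ = O(√γ)`. -/
lemma IsPosDefRiccatiSolution.trace_eq {P : Matrix (Fin n) (Fin n) ℝ}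
    (h : IsPosDefRiccatiSolution A B γ P) (himag : ∀ l ∈ eigenvalueMultiset A, l.re = 0) :
    (Bᵀ * P * B).trace = n * γ := by
  have hu := (Matrix.isUnit_iff_isUnit_det _).1 h.posDef.isUnit
  rw [Matrix.mul_assoc, Matrix.trace_mul_comm, Matrix.mul_assoc, ← h.lyapunov]
  simp only [mul_add, Matrix.mul_smul, Matrix.trace_add, Matrix.trace_smul]
  rw [Matrix.mul_nonsing_inv _ hu, ← mul_assoc P P⁻¹, Matrix.mul_nonsing_inv _ hu, one_mul,
    Matrix.trace_mul_comm, Matrix.mul_assoc, Matrix.nonsing_inv_mul _ hu, mul_one,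
    Matrix.trace_transpose, trace_eq_zero_of_imaginary himag, Matrix.trace_one]
  simp [mul_comm]

/-- `P⁻¹ - P₁⁻¹` solves the Lyapunov equation at `γ` with right-hand side `(1 - γ) P₁⁻¹ ≥ 0`, so it
is nonnegative. This bounds the transformed input matrices independently of `γ`. -/
lemma IsPosDefRiccatiSolution.dotProduct_mulVec_le {P P₁ : Matrix (Fin n) (Fin n) ℝ}
    (h : IsPosDefRiccatiSolution A B γ P) (h₁ : IsPosDefRiccatiSolution A B 1 P₁)
    (himag : ∀ l ∈ eigenvalueMultiset A, l.re = 0) (hγ : 0 < γ) (hγ1 : γ ≤ 1) (v : Fin n → ℝ) :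
    v ⬝ᵥ P *ᵥ v ≤ v ⬝ᵥ P₁ *ᵥ v := by
  have hu := (Matrix.isUnit_iff_isUnit_det _).1 h.posDef.isUnit
  have hu₁ := (Matrix.isUnit_iff_isUnit_det _).1 h₁.posDef.isUnit
  have hPT : Pᵀ = P := by simpa using h.posDef.isHermitian.eq
  have hPT₁ : P₁ᵀ = P₁ := by simpa using h₁.posDef.isHermitian.eq
  have hD : ∀ w : Fin n → ℝ, 0 ≤ w ⬝ᵥ (P⁻¹ - P₁⁻¹) *ᵥ w := by
    refine dotProduct_mulVec_nonneg_of_lyapunov (tendsto_exp_shift_zero A himag hγ) fun w => ?_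
    have e : A * (P⁻¹ - P₁⁻¹) + (P⁻¹ - P₁⁻¹) * Aᵀ + γ • (P⁻¹ - P₁⁻¹) = (1 - γ) • P₁⁻¹ := by
      have e1 := h.lyapunov
      have e2 := h₁.lyapunov
      rw [one_smul] at e2
      have e3 : A * P₁⁻¹ + P₁⁻¹ * Aᵀ = B * Bᵀ - P₁⁻¹ := by rw [← e2]; abel
      have e4 : A * P⁻¹ + P⁻¹ * Aᵀ = B * Bᵀ - γ • P⁻¹ := by rw [← e1]; abel
      calc _ = (A * P⁻¹ + P⁻¹ * Aᵀ) - (A * P₁⁻¹ + P₁⁻¹ * Aᵀ) + γ • (P⁻¹ - P₁⁻¹) := by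
            rw [mul_sub, sub_mul]; abel
        _ = _ := by rw [e3, e4, smul_sub, sub_smul, one_smul]; abel
    rw [shifted_lyapunov, e, Matrix.smul_mulVec, dotProduct_smul]
    have := h₁.posDef.inv.posSemidef.dotProduct_mulVec_nonneg w
    rw [star_trivial] at this
    exact mul_nonneg (by linarith) this
  have h1 := hD (P *ᵥ v)
  -- Reverses the order under inversion: expanding this square gives `2 vᵀPv ≤ vᵀP₁v +
  -- (Pv)ᵀP₁⁻¹(Pv)`, and the last term is at most `vᵀPv`.
  have h2 := h₁.posDef.inv.posSemidef.dotProduct_mulVec_nonneg (P *ᵥ v - P₁ *ᵥ v)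
  rw [star_trivial] at h2
  have e1 : (P *ᵥ v) ⬝ᵥ P⁻¹ *ᵥ (P *ᵥ v) = v ⬝ᵥ P *ᵥ v := by
    rw [Matrix.mulVec_mulVec, Matrix.nonsing_inv_mul _ hu, Matrix.one_mulVec, dotProduct_comm]
  have e2 : P₁⁻¹ *ᵥ (P₁ *ᵥ v) = v := by
    rw [Matrix.mulVec_mulVec, Matrix.nonsing_inv_mul _ hu₁, Matrix.one_mulVec]
  have e3 : (P₁ *ᵥ v) ⬝ᵥ P₁⁻¹ *ᵥ (P *ᵥ v) = v ⬝ᵥ P *ᵥ v := by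
    rw [Matrix.dotProduct_mulVec, ← Matrix.mulVec_transpose, Matrix.transpose_nonsing_inv, hPT₁, e2]
  rw [Matrix.sub_mulVec, dotProduct_sub, e1] at h1
  rw [Matrix.mulVec_sub, e2, sub_dotProduct, dotProduct_sub, dotProduct_sub, e3,
    dotProduct_comm (P *ᵥ v) v, dotProduct_comm (P₁ *ᵥ v) v] at h2
  linarith

lemma trace_conj_eq_sum (P : Matrix (Fin n) (Fin n) ℝ) (C : Matrix (Fin n) (Fin m) ℝ) :
    (Cᵀ * P * C).trace = ∑ j, (fun i => C i j) ⬝ᵥ P *ᵥ (fun i => C i j) := by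
  refine Finset.sum_congr rfl fun j _ => ?_
  rw [Matrix.diag_apply, Matrix.mul_assoc, Matrix.mul_apply]
  rfl

end Riccati

/-! ### Real matrices as operators on complex Euclidean space -/

section Complexification

variable {p q r : ℕ}

/-- The operator between complex Euclidean spaces given by a real matrix. -/
def complexOp (M : Matrix (Fin p) (Fin q) ℝ) :
    EuclideanSpace ℂ (Fin q) →L[ℂ] EuclideanSpace ℂ (Fin p) :=
  LinearMap.toContinuousLinearMap (Matrix.toEuclideanLin (M.map (algebraMap ℝ ℂ)))

/-- The embedding of `ℝᵖ` into the complex Euclidean space. -/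
def complexVec : (Fin p → ℝ) →L[ℝ] EuclideanSpace ℂ (Fin p) :=
  LinearMap.toContinuousLinearMap
    { toFun := fun v => WithLp.toLp 2 fun i => (v i : ℂ)
      map_add' := fun v w => by ext i; simp
      map_smul' := fun c v => by ext i; simp }

@[simp] lemma complexVec_apply (v : Fin p → ℝ) (i : Fin p) : complexVec v i = (v i : ℂ) := rfl

lemma complexOp_apply (M : Matrix (Fin p) (Fin q) ℝ) (v : EuclideanSpace ℂ (Fin q)) (i : Fin p) :
    complexOp M v i = ∑ j, (M i j : ℂ) * v j := rfl

lemma complexOp_complexVec (M : Matrix (Fin p) (Fin q) ℝ) (v : Fin q → ℝ) :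
    complexOp M (complexVec v) = complexVec (M *ᵥ v) := by
  ext i
  simp [complexOp_apply, Matrix.mulVec, dotProduct]

lemma complexOp_mul (M : Matrix (Fin p) (Fin q) ℝ) (N : Matrix (Fin q) (Fin r) ℝ) :
    complexOp (M * N) = complexOp M ∘L complexOp N := by
  ext v i
  simp only [complexOp_apply, ContinuousLinearMap.comp_apply, Matrix.mul_apply, Finset.mul_sum,
    Complex.ofReal_sum, Complex.ofReal_mul, Finset.sum_mul]
  rw [Finset.sum_comm]
  simp only [mul_assoc]

/-- `complexOp` as a real-linear map. -/
def complexOpLinear :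
    Matrix (Fin p) (Fin q) ℝ →ₗ[ℝ] EuclideanSpace ℂ (Fin q) →L[ℂ] EuclideanSpace ℂ (Fin p) where
  toFun := complexOp
  map_add' M N := by ext v i; simp [complexOp_apply, add_mul, Finset.sum_add_distrib]
  map_smul' c M := by ext v i; simp [complexOp_apply, Finset.mul_sum, mul_assoc]

lemma complexOp_add (M N : Matrix (Fin p) (Fin q) ℝ) :
    complexOp (M + N) = complexOp M + complexOp N := map_add complexOpLinear M N

lemma complexOp_sub (M N : Matrix (Fin p) (Fin q) ℝ) :
    complexOp (M - N) = complexOp M - complexOp N := map_sub complexOpLinear M N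

lemma complexOp_neg (M : Matrix (Fin p) (Fin q) ℝ) : complexOp (-M) = -complexOp M :=
  map_neg complexOpLinear M

lemma complexOp_smul (c : ℝ) (M : Matrix (Fin p) (Fin q) ℝ) :
    complexOp (c • M) = c • complexOp M := map_smul complexOpLinear c M

lemma complexOp_sum {ι : Type*} (s : Finset ι) (M : ι → Matrix (Fin p) (Fin q) ℝ) :
    complexOp (∑ k ∈ s, M k) = ∑ k ∈ s, complexOp (M k) := map_sum complexOpLinear M s

lemma complexOp_one : complexOp (1 : Matrix (Fin p) (Fin p) ℝ) = 1 := by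
  ext v i
  simp [complexOp_apply, Matrix.one_apply, apply_ite ((↑) : ℝ → ℂ)]

lemma complexOp_transpose (M : Matrix (Fin p) (Fin q) ℝ) :
    complexOp Mᵀ = (complexOp M).adjoint := by
  rw [complexOp, complexOp, ← LinearMap.adjoint_toContinuousLinearMap,
    ← Matrix.toEuclideanLin_conjTranspose_eq_adjoint]
  congr 2
  ext i j; simp

lemma complexOp_exp (M : Matrix (Fin p) (Fin p) ℝ) :
    complexOp (NormedSpace.exp M) = NormedSpace.exp (complexOp M) := by
  let _ : NormedRing (Matrix (Fin p) (Fin p) ℝ) := Matrix.linftyOpNormedRing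
  let _ : NormedAlgebra ℝ (Matrix (Fin p) (Fin p) ℝ) := Matrix.linftyOpNormedAlgebra
  let _ : NormedAlgebra ℚ (Matrix (Fin p) (Fin p) ℝ) := NormedAlgebra.restrictScalars ℚ ℝ _
  have : CompleteSpace (Matrix (Fin p) (Fin p) ℝ) := FiniteDimensional.complete ℝ _
  let f : Matrix (Fin p) (Fin p) ℝ →+* EuclideanSpace ℂ (Fin p) →L[ℂ] EuclideanSpace ℂ (Fin p) :=
    { toFun := complexOp
      map_one' := complexOp_one
      map_mul' := complexOp_mul
      map_zero' := map_zero complexOpLinear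
      map_add' := complexOp_add }
  exact NormedSpace.map_exp f
    (LinearMap.continuous_of_finiteDimensional (complexOpLinear (p := p) (q := p))) M

/-- The operator norm is at most the Frobenius norm, by Cauchy–Schwarz in each row. -/
lemma norm_complexOp_sq_le (M : Matrix (Fin p) (Fin q) ℝ) :
    ‖complexOp M‖ ^ 2 ≤ (Mᵀ * M).trace := by
  have htr : (Mᵀ * M).trace = ∑ i, ∑ j, M i j ^ 2 := by
    rw [Finset.sum_comm]
    simp [Matrix.trace, Matrix.mul_apply, sq]
  have h0 : 0 ≤ (Mᵀ * M).trace := by rw [htr]; positivity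
  have h1 : ‖complexOp M‖ ≤ √(Mᵀ * M).trace := by
    refine ContinuousLinearMap.opNorm_le_bound _ (Real.sqrt_nonneg _) fun v => ?_
    refine le_of_sq_le_sq ?_ (by positivity)
    rw [mul_pow, Real.sq_sqrt h0, htr, EuclideanSpace.norm_sq_eq, EuclideanSpace.norm_sq_eq,
      Finset.sum_mul]
    refine Finset.sum_le_sum fun i _ => ?_
    rw [complexOp_apply]
    calc ‖∑ j, (M i j : ℂ) * v j‖ ^ 2 ≤ (∑ j, |M i j| * ‖v j‖) ^ 2 := by
          gcongr
          refine norm_sum_le_of_le _ fun j _ => ?_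
          rw [norm_mul, Complex.norm_real, Real.norm_eq_abs]
      _ ≤ (∑ j, |M i j| ^ 2) * ∑ j, ‖v j‖ ^ 2 := Finset.sum_mul_sq_le_sq_mul_sq _ _ _
      _ = _ := by simp only [sq_abs]
  calc ‖complexOp M‖ ^ 2 ≤ (√(Mᵀ * M).trace) ^ 2 := by gcongr
    _ = _ := Real.sq_sqrt h0

end Complexification

/-! ### Decoupling the network by peeling the characteristic polynomial -/

section Network

lemma commute_aeval_self {R 𝔸 : Type*} [CommRing R] [Ring 𝔸] [Algebra R 𝔸] (a : 𝔸)
    (f : Polynomial R) : Commute (Polynomial.aeval a f) a := by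
  have h : Commute (Polynomial.aeval a f)
      (Polynomial.aeval a (Polynomial.X : Polynomial R)) := by
    rw [commute_iff_eq, ← map_mul, mul_comm, map_mul]
  rwa [Polynomial.aeval_X] at h

variable {N : ℕ} {E U : Type*} [NormedAddCommGroup E] [NormedSpace ℂ E]
  [NormedAddCommGroup U] [NormedSpace ℂ U]

/-- If every mode `ẋ = A x + ∑ₖ Bₖ (l K x + d)(t - τₖ)`, `l ∈ Λ`, is asymptotically stable under
vanishing disturbances, then the Laplacian combinations of the coupled agents tend to zero. -/
theorem tendsto_laplacian_zero (A : E →L[ℂ] E) (B : Fin 3 → U →L[ℂ] E) (K : E →L[ℂ] U)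
    (τ : Fin 3 → ℝ) (L : Matrix (Fin N) (Fin N) ℂ) (Λ : Multiset ℂ)
    (hchar : L.charpoly
      = Polynomial.X * (Λ.map fun l => Polynomial.X - Polynomial.C l).prod)
    (hmode : ∀ l ∈ Λ, ∀ (x : ℝ → E) (d : ℝ → U), Continuous x → Continuous d →
      Tendsto d atTop (𝓝 0) →
      (∀ t, 0 ≤ t → HasDerivWithinAt x
        (A (x t) + ∑ k, B k (l • K (x (t - τ k)) + d (t - τ k))) (Set.Ici 0) t) →
      Tendsto x atTop (𝓝 0))
    (X : Fin N → ℝ → E) (hX : ∀ i, Continuous (X i))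
    (hode : ∀ i t, 0 ≤ t → HasDerivWithinAt (X i)
      (A (X i t) + ∑ k, B k (K (∑ j, L i j • X j (t - τ k)))) (Set.Ici 0) t) (i : Fin N) :
    Tendsto (fun t => ∑ j, L i j • X j t) atTop (𝓝 0) := by
  let Z : Matrix (Fin N) (Fin N) ℂ → Fin N → ℝ → E := fun M i t => ∑ j, M i j • X j t
  have hZc : ∀ M i, Continuous (Z M i) := fun M i =>
    continuous_finsetSum _ fun j _ => (hX j).const_smul _
  have hZadd : ∀ M M' i t, Z (M + M') i t = Z M i t + Z M' i t := fun M M' i t => by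
    simp [Z, add_smul, Finset.sum_add_distrib]
  have hZsmul : ∀ (c : ℂ) M i t, Z (c • M) i t = c • Z M i t := fun c M i t => by
    simp [Z, Finset.smul_sum, smul_smul]
  have hZmul : ∀ M M' i t, ∑ j, M i j • Z M' j t = Z (M * M') i t := fun M M' i t => by
    simp only [Z, Finset.smul_sum, smul_smul, Matrix.mul_apply, Finset.sum_smul]
    exact Finset.sum_comm
  have hZode : ∀ M, Commute M L → ∀ i t, 0 ≤ t → HasDerivWithinAt (Z M i)
      (A (Z M i t) + ∑ k, B k (K (Z (L * M) i (t - τ k)))) (Set.Ici 0) t := by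
    intro M hM i t ht
    refine (HasDerivWithinAt.fun_sum (u := Finset.univ) fun j _ =>
      (hode j t ht).const_smul (M i j)).congr_deriv ?_
    have h1 : ∀ s, Z (L * M) i s = ∑ j, M i j • ∑ q, L j q • X q s := fun s => by
      rw [← hM.eq]; exact (hZmul M L i s).symm
    simp only [h1, smul_add, Finset.sum_add_distrib, map_sum, map_smul, Finset.smul_sum, Z]
    congr 1
    exact Finset.sum_comm
  -- Splitting `L M = l M + (L - l) M` exhibits `M x` as a mode for `l` whose disturbance vanishes
  -- by assumption.
  have hstep : ∀ l ∈ Λ, ∀ M, Commute M L →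
      (∀ i, Tendsto (Z ((L - l • 1) * M) i) atTop (𝓝 0)) → ∀ i, Tendsto (Z M i) atTop (𝓝 0) := by
    intro l hl M hM hlim i
    refine hmode l hl (Z M i) (fun t => K (Z ((L - l • 1) * M) i t)) (hZc M i)
      (K.continuous.comp (hZc _ i)) ?_ fun t ht => ?_
    · simpa [Function.comp_def] using (K.continuous.tendsto 0).comp (hlim i)
    · refine (hZode M hM i t ht).congr_deriv ?_
      congr 1
      refine Finset.sum_congr rfl fun k _ => ?_
      congr 1
      rw [← map_smul, ← map_add, ← hZsmul, ← hZadd]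
      congr 2
      rw [sub_mul, Matrix.smul_mul, one_mul]; abel
  have hpeel : ∀ s : Multiset ℂ, (∀ l ∈ s, l ∈ Λ) → ∀ f : Polynomial ℂ,
      (∀ i, Tendsto (Z (Polynomial.aeval L
        ((s.map fun l => Polynomial.X - Polynomial.C l).prod * f)) i) atTop (𝓝 0)) →
      ∀ i, Tendsto (Z (Polynomial.aeval L f) i) atTop (𝓝 0) := by
    intro s
    induction s using Multiset.induction_on with
    | empty => intro _ f hf; simpa using hf
    | cons a s ih =>
      intro hs f hf
      refine ih (fun l hl => hs l (Multiset.mem_cons_of_mem hl)) f ?_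
      refine hstep a (hs a (Multiset.mem_cons_self a s)) _
        (commute_aeval_self L _) ?_
      have : (L - a • 1) * Polynomial.aeval L
          ((s.map fun l => Polynomial.X - Polynomial.C l).prod * f) = Polynomial.aeval L
          (((a ::ₘ s).map fun l => Polynomial.X - Polynomial.C l).prod * f) := by
        rw [Multiset.map_cons, Multiset.prod_cons, mul_assoc (Polynomial.X - Polynomial.C a),
          map_mul (Polynomial.aeval L) (Polynomial.X - Polynomial.C a), map_sub,
          Polynomial.aeval_X, Polynomial.aeval_C, Algebra.algebraMap_eq_smul_one]
      rw [this]; exact hf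
  -- The peeling starts from the identically zero combination `χ_L(L) x`. The factor `X` of the
  -- eigenvalue `0` is never removed, which leaves `L x`.
  have hfin := hpeel Λ (fun l hl => hl) Polynomial.X (fun i => by
    rw [mul_comm, ← hchar, Matrix.aeval_self_charpoly]
    simp [Z]) i
  rw [Polynomial.aeval_X] at hfin
  exact hfin

end Network

/-! ### Vanishing of the collected signals -/

section ClosedLoop

variable {n m N : ℕ}

lemma collected_eq_sum (G : WeightedDigraph N) (x : Fin N → ℝ → Fin n → ℝ) (i : Fin N) (t : ℝ) :
    collected G x i t = ∑ j, G.laplacian i j • x j t := by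
  funext a
  have := G.laplacian_mulVec (fun j => x j t a) i
  simp only [collected, Finset.sum_apply, Pi.smul_apply, Pi.sub_apply, smul_eq_mul]
  rw [← this]; rfl

lemma IsClosedLoopTrajectory.hasDerivWithinAt {A : Matrix (Fin n) (Fin n) ℝ}
    {B : Fin 3 → Matrix (Fin n) (Fin m) ℝ} {τ : Fin 3 → ℝ} {G : WeightedDigraph N}
    {K : Matrix (Fin m) (Fin n) ℝ} {x : Fin N → ℝ → Fin n → ℝ} {u : Fin N → ℝ → Fin m → ℝ}
    (h : IsClosedLoopTrajectory A B τ G K x u) (hτ : ∀ k, τ k ≤ τ 2) (i : Fin N) {t : ℝ}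
    (ht : 0 ≤ t) :
    HasDerivWithinAt (x i) (A *ᵥ x i t + ∑ k, B k *ᵥ (K *ᵥ collected G x i (t - τ k)))
      (Set.Ici 0) t := by
  have h1 := h.dynamics i t ht
  have h2 : ∀ k, u i (t - τ k) = K *ᵥ collected G x i (t - τ k) := fun k =>
    h.protocol i _ (by linarith [hτ k])
  simpa only [h2] using h1

lemma exists_isUnit_eq_transpose_mul_self {P : Matrix (Fin n) (Fin n) ℝ} (hP : P.PosDef) :
    ∃ R : Matrix (Fin n) (Fin n) ℝ, IsUnit R.det ∧ P = Rᵀ * R := by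
  open scoped MatrixOrder in
  obtain ⟨R, hR⟩ := CStarAlgebra.nonneg_iff_eq_star_mul_self.1 hP.posSemidef.nonneg
  rw [Matrix.star_eq_conjTranspose, Matrix.conjTranspose_eq_transpose_of_trivial] at hR
  refine ⟨R, ?_, hR⟩
  have h1 := (Matrix.isUnit_iff_isUnit_det _).1 hP.isUnit
  rw [hR, Matrix.det_mul] at h1
  exact isUnit_of_mul_isUnit_right h1

/-- The collected signals vanish asymptotically when `√γ` is small against the gain constants. -/
lemma tendsto_collected_zero {A : Matrix (Fin n) (Fin n) ℝ}
    {B : Fin 3 → Matrix (Fin n) (Fin m) ℝ} {τ : Fin 3 → ℝ} {G : WeightedDigraph N}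
    (hτ0 : ∀ k, 0 ≤ τ k) (hτ : ∀ k, τ k ≤ τ 2)
    (himag : ∀ l ∈ eigenvalueMultiset A, l.re = 0) {Λ : Multiset ℂ}
    (hΛ : eigenvalueMultiset G.laplacian = 0 ::ₘ Λ) {μ ℓ b γ : ℝ} (hμ : 0 < μ)
    (hμΛ : ∀ l ∈ Λ, 1 ≤ μ * l.re) (hℓ : ∀ l ∈ Λ, ‖l‖ ≤ ℓ) (hγ : 0 < γ) (hγ1 : γ ≤ 1)
    {P : Matrix (Fin n) (Fin n) ℝ}
    (hP : IsPosDefRiccatiSolution A (delayFreeInput A B τ) γ P) (hb0 : 0 ≤ b)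
    (hb : ∀ k, ((B k)ᵀ * P * B k).trace ≤ b ^ 2)
    (hsmall : (lyapunovConst (n + 1) b μ ℓ (τ 2) (totalDelay τ)
      + reductionConst (n + 1) b μ ℓ (τ 2) (totalDelay τ)) * √γ ≤ 1 / 2)
    {x : Fin N → ℝ → Fin n → ℝ} {u : Fin N → ℝ → Fin m → ℝ}
    (hx : IsClosedLoopTrajectory A B τ G (protocolGain A (delayFreeInput A B τ)
      (-((delayFreeInput A B τ)ᵀ * P)) μ (totalDelay τ)) x u) (i : Fin N) :
    Tendsto (collected G x i) atTop (𝓝 0) := by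
  set Bs := delayFreeInput A B τ with hBs
  set T := totalDelay τ with hT
  set K := protocolGain A Bs (-(Bsᵀ * P)) μ T with hK
  obtain ⟨R, hR, hPR⟩ := exists_isUnit_eq_transpose_mul_self hP.posDef
  have hRR : R * R⁻¹ = 1 := Matrix.mul_nonsing_inv _ hR
  have hRR' : R⁻¹ * R = 1 := Matrix.nonsing_inv_mul _ hR
  have hRu : IsUnit R := (Matrix.isUnit_iff_isUnit_det _).2 hR
  have hRT : R⁻¹ᵀ * Rᵀ = 1 := by rw [← Matrix.transpose_mul, hRR, Matrix.transpose_one]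
  -- In the coordinates `R x`, where `P = Rᵀ R`, the Riccati solution becomes the identity.
  set At := R * A * R⁻¹ with hAt
  set Bt := R * Bs with hBt
  have hexp : ∀ s : ℝ, NormedSpace.exp (s • At) = R * NormedSpace.exp (s • A) * R⁻¹ := fun s => by
    rw [← Matrix.exp_conj _ _ hRu, hAt, Matrix.mul_smul, Matrix.smul_mul]
  have hBts : Bt = ∑ k, NormedSpace.exp (-(τ k • At)) * (R * B k) := by
    rw [hBt, hBs, delayFreeInput, Matrix.mul_sum]
    refine Finset.sum_congr rfl fun k _ => ?_
    rw [← neg_smul, ← neg_smul, hexp, Matrix.mul_assoc _ R⁻¹, ← Matrix.mul_assoc R⁻¹, hRR',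
      Matrix.one_mul, Matrix.mul_assoc]
  have hricc : Atᵀ + At - Bt * Btᵀ = -(γ • 1) := by
    have h1 := congrArg (fun X => R⁻¹ᵀ * X * R⁻¹) hP.riccati
    simp only [mul_sub, mul_add, sub_mul, add_mul, mul_neg, neg_mul, Matrix.mul_smul,
      Matrix.smul_mul] at h1
    have e1 : R⁻¹ᵀ * (Aᵀ * P) * R⁻¹ = Atᵀ := by
      rw [hPR, hAt, Matrix.transpose_mul, Matrix.transpose_mul]
      simp only [Matrix.mul_assoc]
      rw [hRR, Matrix.mul_one]
    have e2 : R⁻¹ᵀ * (P * A) * R⁻¹ = At := by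
      rw [hPR, hAt, Matrix.mul_assoc Rᵀ, ← Matrix.mul_assoc R⁻¹ᵀ, hRT, Matrix.one_mul]
    have e3 : R⁻¹ᵀ * (P * Bs * Bsᵀ * P) * R⁻¹ = Bt * Btᵀ := by
      rw [hPR, hBt, Matrix.transpose_mul]
      calc _ = (R⁻¹ᵀ * Rᵀ) * (R * Bs * (Bsᵀ * Rᵀ)) * (R * R⁻¹) := by
            simp only [Matrix.mul_assoc]
        _ = _ := by rw [hRT, hRR, Matrix.one_mul, Matrix.mul_one]
    have e4 : R⁻¹ᵀ * P * R⁻¹ = 1 := by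
      rw [hPR, ← Matrix.mul_assoc, hRT, Matrix.one_mul, hRR]
    rw [e1, e2, e3, e4] at h1
    exact h1
  have hKt : K * R⁻¹ = -(μ • (Btᵀ * (NormedSpace.exp (T • (At - Bt * Btᵀ))
      * NormedSpace.exp (-(T • At))))) := by
    have h1 : At - Bt * Btᵀ = R * (A + Bs * (-(Bsᵀ * P))) * R⁻¹ := by
      rw [hAt, hBt, Matrix.transpose_mul, hPR, mul_add, add_mul,
        Matrix.mul_neg, Matrix.mul_neg, Matrix.neg_mul, sub_eq_add_neg]
      congr 2
      simp only [Matrix.mul_assoc]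
      rw [hRR, Matrix.mul_one]
    have h2 : NormedSpace.exp (T • (At - Bt * Btᵀ))
        = R * NormedSpace.exp (T • (A + Bs * (-(Bsᵀ * P)))) * R⁻¹ := by
      rw [← Matrix.exp_conj _ _ hRu, h1, Matrix.mul_smul, Matrix.smul_mul]
    rw [h2, ← neg_smul T At, hexp, neg_smul, hK, protocolGain, hBt, Matrix.transpose_mul, hPR]
    set X := NormedSpace.exp (T • (A + Bs * (-(Bsᵀ * (Rᵀ * R)))))
    set Y := NormedSpace.exp (-(T • A))
    rw [Matrix.smul_mul, ← smul_neg]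
    congr 1
    simp only [Matrix.neg_mul, Matrix.mul_assoc]
    rw [← Matrix.mul_assoc R⁻¹ R, hRR', Matrix.one_mul]
  have hBtn : (Btᵀ * Bt).trace = n * γ := by
    rw [hBt, Matrix.transpose_mul, ← hP.trace_eq himag, hPR]
    simp only [Matrix.mul_assoc]
  clear_value At Bt
  have hneg : ∀ s : ℝ, (-s) • complexOp At = -(s • complexOp At) := fun s => by
    rw [← complexOp_smul, ← complexOp_smul, ← complexOp_neg, neg_smul]
  have hric : ∀ y, 2 * (inner ℂ y (complexOp At y)).re
      = ‖(complexOp Bt).adjoint y‖ ^ 2 - γ * ‖y‖ ^ 2 := by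
    intro y
    have h1 := congrArg (fun M => (inner ℂ y (complexOp M y)).re) hricc
    simp only [complexOp_sub, complexOp_add, complexOp_neg, complexOp_smul, complexOp_one,
      complexOp_transpose, complexOp_mul] at h1
    simp only [_root_.sub_apply, _root_.add_apply, _root_.neg_apply, _root_.smul_apply,
      one_apply_eq_self, ContinuousLinearMap.comp_apply, inner_sub_right,
      inner_add_right, inner_neg_right, ContinuousLinearMap.adjoint_inner_right] at h1
    have h2 : (inner ℂ y (complexOp Bt ((complexOp Bt).adjoint y))).re
        = ‖(complexOp Bt).adjoint y‖ ^ 2 := by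
      rw [← ContinuousLinearMap.adjoint_inner_left, inner_self_eq_norm_sq_to_K]
      simp [← Complex.ofReal_pow]
    have h3 : (inner ℂ (complexOp At y) y).re = (inner ℂ y (complexOp At y)).re := by
      rw [← inner_conj_symm, Complex.conj_re]
    have h4 : (inner ℂ y (γ • y)).re = γ * ‖y‖ ^ 2 := by
      rw [← Complex.coe_smul, inner_smul_right, inner_self_eq_norm_sq_to_K]
      simp [← Complex.ofReal_pow]
    simp only [Complex.sub_re, Complex.add_re, Complex.neg_re, h2, h3, h4] at h1
    linarith
  have hexpOp : ∀ (s : ℝ) (M : Matrix (Fin n) (Fin n) ℝ),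
      complexOp (NormedSpace.exp (s • M)) = NormedSpace.exp (s • complexOp M) := fun s M => by
    rw [complexOp_exp, complexOp_smul]
  have hmode : ∀ l ∈ Λ, ∀ (z : ℝ → EuclideanSpace ℂ (Fin n)) (d : ℝ → EuclideanSpace ℂ (Fin m)),
      Continuous z → Continuous d → Tendsto d atTop (𝓝 0) →
      (∀ t, 0 ≤ t → HasDerivWithinAt z (complexOp At (z t) + ∑ k, complexOp (R * B k)
        (l • complexOp (K * R⁻¹) (z (t - τ k)) + d (t - τ k))) (Set.Ici 0) t) →
      Tendsto z atTop (𝓝 0) := by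
    intro l hl z d hz hd hdlim hode
    -- The trace identity gives the constant `n`; taking `c = n + 1` also secures `1 ≤ c` when `n =
    -- 0`.
    refine tendsto_zero_of_mode (complexOp At) (fun k => complexOp (R * B k)) (complexOp Bt)
      (γ := γ) (c := n + 1) (b := b) (μ := μ) (ℓ := ℓ) (T := T) hτ0 hτ
      (Finset.sum_nonneg fun k _ => hτ0 k) hγ hγ1 (by linarith [Nat.cast_nonneg (α := ℝ) n]) hμ
      (hμΛ l hl) (hℓ l hl) ?_ hric ?_ ?_ hsmall (complexOp (K * R⁻¹)) ?_ hz hd hdlim hode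
    · rw [hBts, complexOp_sum]
      refine Finset.sum_congr rfl fun k _ => ?_
      rw [complexOp_mul, ← neg_smul, hexpOp, hneg]
    · refine (norm_complexOp_sq_le _).trans ?_
      rw [hBtn]
      nlinarith
    · intro k
      refine le_of_sq_le_sq ((norm_complexOp_sq_le _).trans (le_trans (le_of_eq ?_) (hb k))) hb0
      rw [Matrix.transpose_mul, hPR]
      simp only [Matrix.mul_assoc]
    · intro v
      rw [hKt, complexOp_neg, complexOp_smul, complexOp_mul, complexOp_mul, complexOp_transpose,
        hexpOp, ← neg_smul, hexpOp, complexOp_sub, complexOp_mul, complexOp_transpose, hneg]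
      simp only [_root_.neg_apply, _root_.smul_apply, ContinuousLinearMap.comp_apply,
        Complex.coe_smul]
  have hH : 0 ≤ τ 2 := hτ0 2
  -- The state is frozen before `-τ 2` to make it continuous on the whole line; the dynamics for `t
  -- ≥ 0` never look further back.
  let X : Fin N → ℝ → EuclideanSpace ℂ (Fin n) := fun j t =>
    complexVec (R *ᵥ x j (max t (-τ 2)))
  have hXeq : ∀ j t, -τ 2 ≤ t → X j t = complexVec (R *ᵥ x j t) := fun j t ht => by
    simp only [X, max_eq_left ht]
  have hmv : ∀ {p : ℕ} (M : Matrix (Fin p) (Fin n) ℝ), Continuous fun v : Fin n → ℝ => M *ᵥ v :=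
    fun M => by fun_prop
  have hXc : ∀ j, Continuous (X j) := fun j => complexVec.continuous.comp ((hmv R).comp
    ((hx.continuousOn j).comp_continuous (by fun_prop) fun t => Set.mem_Ici.2 (le_max_right _ _)))
  have hsum : ∀ j t, -τ 2 ≤ t → ∑ q, G.laplacian.map (algebraMap ℝ ℂ) j q • X q t
      = complexVec (R *ᵥ collected G x j t) := by
    intro j t ht
    rw [collected_eq_sum, ← Matrix.mulVecLin_apply, map_sum, map_sum]
    refine Finset.sum_congr rfl fun q _ => ?_
    rw [hXeq q t ht, map_smul, map_smul, Matrix.map_apply, Complex.coe_algebraMap,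
      Complex.coe_smul, Matrix.mulVecLin_apply]
  have hchar : (G.laplacian.map (algebraMap ℝ ℂ)).charpoly
      = Polynomial.X * (Λ.map fun l => Polynomial.X - Polynomial.C l).prod := by
    rw [charpoly_eq_prod_eigenvalueMultiset, hΛ, Multiset.map_cons, Multiset.prod_cons, map_zero,
      sub_zero]
  have hlim := tendsto_laplacian_zero (complexOp At) (fun k => complexOp (R * B k))
    (complexOp (K * R⁻¹)) τ (G.laplacian.map (algebraMap ℝ ℂ)) Λ hchar hmode X hXc (by
      intro j t ht
      have h0 : -τ 2 ≤ t := by linarith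
      let f : (Fin n → ℝ) →L[ℝ] EuclideanSpace ℂ (Fin n) :=
        complexVec ∘L LinearMap.toContinuousLinearMap (Matrix.mulVecLin R)
      have hf : ∀ v, f v = complexVec (R *ᵥ v) := fun v => rfl
      have h1 := f.hasFDerivAt.comp_hasDerivWithinAt t (hx.hasDerivWithinAt hτ j ht)
      have h2 : HasDerivWithinAt (X j) (f (A *ᵥ x j t + ∑ k, B k *ᵥ (K *ᵥ collected G x j (t - τ k))))
          (Set.Ici 0) t := h1.congr (fun s hs => hXeq j s (by linarith [Set.mem_Ici.1 hs])) (hXeq j t h0)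
      refine h2.congr_deriv ?_
      rw [map_add, map_sum]
      congr 1
      · rw [hf, hXeq j t h0, complexOp_complexVec, hAt, Matrix.mulVec_mulVec, Matrix.mulVec_mulVec,
          Matrix.mul_assoc _ R⁻¹, hRR', Matrix.mul_one]
      · refine Finset.sum_congr rfl fun k _ => ?_
        rw [hsum j _ (by linarith [hτ k]), hf, complexOp_complexVec, complexOp_complexVec]
        simp only [Matrix.mulVec_mulVec]
        congr 2
        simp only [Matrix.mul_assoc]
        rw [hRR', Matrix.mul_one]) i
  have hback : Continuous fun v : EuclideanSpace ℂ (Fin n) => R⁻¹ *ᵥ fun a => (v a).re := by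
    refine (hmv R⁻¹).comp (continuous_pi fun a => Complex.continuous_re.comp ?_)
    fun_prop
  have h1 := (hback.tendsto 0).comp hlim
  have h2 : (R⁻¹ *ᵥ fun a => ((0 : EuclideanSpace ℂ (Fin n)) a).re) = 0 := by
    have : (fun a => ((0 : EuclideanSpace ℂ (Fin n)) a).re) = 0 := by ext a; simp
    rw [this, Matrix.mulVec_zero]
  rw [h2] at h1
  refine h1.congr' ?_
  filter_upwards [eventually_ge_atTop (-τ 2)] with t ht
  simp only [Function.comp_apply, hsum i t ht, complexVec_apply, Complex.ofReal_re]
  rw [Matrix.mulVec_mulVec, hRR', Matrix.one_mulVec]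

end ClosedLoop

/-! ### The reference trajectory and its growth -/

section Reference

variable {n m N : ℕ}

lemma vecNorm_nonneg (v : Fin n → ℝ) : 0 ≤ vecNorm v := norm_nonneg _

lemma vecNorm_add_le (v w : Fin n → ℝ) : vecNorm (v + w) ≤ vecNorm v + vecNorm w :=
  norm_add_le (WithLp.toLp 2 v) (WithLp.toLp 2 w)

lemma continuous_vecNorm : Continuous (vecNorm (n := n)) :=
  (PiLp.continuous_toLp 2 _).norm

lemma vecNorm_zero : vecNorm (0 : Fin n → ℝ) = 0 := by simp [vecNorm]

lemma vecNorm_neg (v : Fin n → ℝ) : vecNorm (-v) = vecNorm v := by simp [vecNorm]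

lemma vecNorm_le_sum (v : Fin n → ℝ) : vecNorm v ≤ ∑ i, |v i| := by
  refine le_of_sq_le_sq ?_ (by positivity)
  rw [vecNorm, EuclideanSpace.norm_sq_eq]
  exact Finset.sum_sq_le_sq_sum_of_nonneg fun i _ => norm_nonneg _

lemma tendsto_vecNorm_zero {f : ℝ → Fin n → ℝ} (hf : Tendsto f atTop (𝓝 0)) :
    Tendsto (fun t => vecNorm (f t)) atTop (𝓝 0) := by
  simpa [Function.comp_def, vecNorm_zero] using (continuous_vecNorm.tendsto 0).comp hf

lemma hasDerivAt_exp_smul_mulVec (A : Matrix (Fin n) (Fin n) ℝ) (v : Fin n → ℝ) (t : ℝ) :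
    HasDerivAt (fun t : ℝ => NormedSpace.exp (t • A) *ᵥ v) (A *ᵥ (NormedSpace.exp (t • A) *ᵥ v)) t := by
  let _ : NormedRing (Matrix (Fin n) (Fin n) ℝ) := Matrix.linftyOpNormedRing
  let _ : NormedAlgebra ℝ (Matrix (Fin n) (Fin n) ℝ) := Matrix.linftyOpNormedAlgebra
  have : CompleteSpace (Matrix (Fin n) (Fin n) ℝ) := FiniteDimensional.complete ℝ _
  let f : Matrix (Fin n) (Fin n) ℝ →ₗ[ℝ] Fin n → ℝ :=
    { toFun := fun X => X *ᵥ v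
      map_add' := fun X Y => Matrix.add_mulVec X Y v
      map_smul' := fun r X => Matrix.smul_mulVec r X v }
  have h := (LinearMap.toContinuousLinearMap f).hasFDerivAt.comp_hasDerivAt t
    (hasDerivAt_exp_smul_const' (𝕂 := ℝ) A t)
  refine h.congr_deriv ?_
  rw [Matrix.mulVec_mulVec]
  rfl

lemma eq_exp_smul_mulVec_of_hasDerivWithinAt {A : Matrix (Fin n) (Fin n) ℝ} {y : ℝ → Fin n → ℝ}
    (hy : ∀ t, 0 ≤ t → HasDerivWithinAt y (A *ᵥ y t) (Set.Ici 0) t) {t : ℝ} (ht : 0 ≤ t) :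
    y t = NormedSpace.exp (t • A) *ᵥ y 0 := by
  let f : (Fin n → ℝ) →L[ℝ] (Fin n → ℝ) := LinearMap.toContinuousLinearMap (Matrix.mulVecLin A)
  refine ODE_solution_unique (v := fun _ z => f z) (fun _ => f.lipschitz)
    (g := fun t => NormedSpace.exp (t • A) *ᵥ y 0) (a := 0) (b := t)
    (fun s hs => (hy s hs.1).continuousWithinAt.mono fun r hr => hr.1)
    (fun s hs => (hy s hs.1).mono (Set.Ici_subset_Ici.2 hs.1))
    (fun s _ => (hasDerivAt_exp_smul_mulVec A (y 0) s).continuousAt.continuousWithinAt)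
    (fun s _ => (hasDerivAt_exp_smul_mulVec A (y 0) s).hasDerivWithinAt)
    (by simp) ⟨ht, le_rfl⟩

lemma exists_vecNorm_exp_smul_le (A : Matrix (Fin n) (Fin n) ℝ)
    (himag : ∀ l ∈ eigenvalueMultiset A, l.re = 0) :
    ∃ c, 0 < c ∧ ∀ t : ℝ, 0 ≤ t → ∀ v : Fin n → ℝ, vecNorm (NormedSpace.exp (t • A) *ᵥ v)
      ≤ c * (1 + ∑ j, |v j|) * (1 + t ^ (maxAlgMultiplicity A - 1)) := by
  obtain ⟨c, hc0, hc⟩ := exists_abs_exp_smul_apply_le A himag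
  -- The added `1`, here and in `1 + ∑ j, |v j|`, keeps the bound strictly positive even when `n`,
  -- `c` or `v` is zero.
  refine ⟨n * c + 1, by positivity, fun t ht v => (vecNorm_le_sum _).trans ?_⟩
  have h1 : ∀ i, |(NormedSpace.exp (t • A) *ᵥ v) i|
      ≤ c * (1 + t ^ (maxAlgMultiplicity A - 1)) * ∑ j, |v j| := by
    intro i
    rw [Finset.mul_sum, Matrix.mulVec, dotProduct]
    refine (Finset.abs_sum_le_sum_abs _ _).trans ?_
    refine Finset.sum_le_sum fun j _ => ?_
    rw [abs_mul]
    have := hc t i j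
    rw [abs_of_nonneg ht] at this
    gcongr
  refine (Finset.sum_le_sum fun i _ => h1 i).trans ?_
  rw [Finset.sum_const, Finset.card_univ, Fintype.card_fin, nsmul_eq_mul]
  have h2 : 0 ≤ ∑ j, |v j| := by positivity
  have h3 : 0 ≤ t ^ (maxAlgMultiplicity A - 1) := by positivity
  calc _ = n * c * (∑ j, |v j|) * (1 + t ^ (maxAlgMultiplicity A - 1)) := by ring
    _ ≤ (n * c + 1) * (1 + ∑ j, |v j|) * (1 + t ^ (maxAlgMultiplicity A - 1)) := by
        gcongr <;> linarith

/-- The averaging matrix `p(L) / p(0)`, where `X * p` is the characteristic polynomial of `L`. -/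
def averagingMatrix (L : Matrix (Fin N) (Fin N) ℝ) (p : Polynomial ℝ) :
    Matrix (Fin N) (Fin N) ℝ := (p.eval 0)⁻¹ • Polynomial.aeval L p

lemma mul_averagingMatrix {L : Matrix (Fin N) (Fin N) ℝ} {p : Polynomial ℝ}
    (hp : L.charpoly = Polynomial.X * p) : L * averagingMatrix L p = 0 := by
  rw [averagingMatrix, Matrix.mul_smul]
  have := Matrix.aeval_self_charpoly L
  rw [hp, map_mul, Polynomial.aeval_X] at this
  rw [this, smul_zero]

lemma averagingMatrix_mul {L : Matrix (Fin N) (Fin N) ℝ} {p : Polynomial ℝ}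
    (hp : L.charpoly = Polynomial.X * p) : averagingMatrix L p * L = 0 := by
  rw [averagingMatrix, Matrix.smul_mul]
  have := Matrix.aeval_self_charpoly L
  rw [hp, mul_comm, map_mul, Polynomial.aeval_X] at this
  rw [this, smul_zero]

/-- Separating the constant term of `p` shows that averaging differs from the identity by a multiple
of `L`, so `x - Q x` is controlled by the collected signals. -/
lemma averagingMatrix_eq {L : Matrix (Fin N) (Fin N) ℝ} {p : Polynomial ℝ} (h0 : p.eval 0 ≠ 0) :
    averagingMatrix L p = 1 + ((p.eval 0)⁻¹ • Polynomial.aeval L p.divX) * L := by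
  have h1 := congrArg (Polynomial.aeval L) (Polynomial.divX_mul_X_add p)
  rw [map_add, map_mul, Polynomial.aeval_X, Polynomial.aeval_C, Polynomial.coeff_zero_eq_eval_zero,
    Algebra.algebraMap_eq_smul_one] at h1
  rw [averagingMatrix, ← h1, smul_add, smul_smul, inv_mul_cancel₀ h0, one_smul, Matrix.smul_mul,
    add_comm]

/-- The weighted average of the agents is a reference trajectory: it follows `ṡ = A s`. -/
lemma tendsto_sub_average {A : Matrix (Fin n) (Fin n) ℝ}
    {B : Fin 3 → Matrix (Fin n) (Fin m) ℝ} {τ : Fin 3 → ℝ} {G : WeightedDigraph N}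
    {K : Matrix (Fin m) (Fin n) ℝ} {x : Fin N → ℝ → Fin n → ℝ} {u : Fin N → ℝ → Fin m → ℝ}
    (hx : IsClosedLoopTrajectory A B τ G K x u) (hτ : ∀ k, τ k ≤ τ 2)
    (hG : G.HasDirectedSpanningTree) {p : Polynomial ℝ}
    (hp : G.laplacian.charpoly = Polynomial.X * p) (h0 : p.eval 0 ≠ 0)
    (hcol : ∀ i, Tendsto (collected G x i) atTop (𝓝 0)) (r i : Fin N) :
    Tendsto (fun t => x i t
      - NormedSpace.exp (t • A) *ᵥ ∑ j, averagingMatrix G.laplacian p r j • x j 0) atTop (𝓝 0) := by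
  set L := G.laplacian
  set Q := averagingMatrix L p with hQ
  let S : Fin N → ℝ → Fin n → ℝ := fun i t => ∑ j, Q i j • x j t
  have hcomb : ∀ (M : Matrix (Fin N) (Fin N) ℝ) i t,
      ∑ j, M i j • collected G x j t = ∑ q, (M * L) i q • x q t := by
    intro M i t
    simp only [collected_eq_sum, Finset.smul_sum, smul_smul, Matrix.mul_apply, Finset.sum_smul]
    exact Finset.sum_comm
  have hSode : ∀ i t, 0 ≤ t → HasDerivWithinAt (S i) (A *ᵥ S i t) (Set.Ici 0) t := by
    intro i t ht
    refine (HasDerivWithinAt.fun_sum (u := Finset.univ) fun j _ =>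
      (hx.hasDerivWithinAt hτ j ht).const_smul (Q i j)).congr_deriv ?_
    -- `Q L = 0` cancels every input, so the average evolves by `A` alone. The other product, `L Q =
    -- 0`, makes all rows of the average agree.
    have h1 : ∀ k, ∑ j, Q i j • (B k *ᵥ (K *ᵥ collected G x j (t - τ k))) = 0 := by
      intro k
      have h2 := hcomb Q i (t - τ k)
      rw [hQ, averagingMatrix_mul hp, ← hQ] at h2
      have h3 := congrArg (fun v => B k *ᵥ (K *ᵥ v)) h2
      simpa only [Matrix.mulVec_sum, Matrix.mulVec_smul, Matrix.zero_apply, zero_smul,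
        Finset.sum_const_zero, Matrix.mulVec_zero] using h3
    simp only [smul_add, Finset.sum_add_distrib, Finset.smul_sum, S, Matrix.mulVec_sum,
      Matrix.mulVec_smul]
    rw [add_eq_left, Finset.sum_comm]
    exact Finset.sum_eq_zero fun k _ => h1 k
  have hSeq : ∀ t, S i t = S r t := by
    intro t
    funext a
    have h1 : L *ᵥ (fun j => S j t a) = 0 := by
      have h2 : (fun j => S j t a) = Q *ᵥ fun j => x j t a := by
        funext j
        simp [S, Matrix.mulVec, dotProduct]
      rw [h2, Matrix.mulVec_mulVec, hQ, mul_averagingMatrix hp, Matrix.zero_mulVec]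
    exact WeightedDigraph.eq_of_laplacian_mulVec_eq_zero hG h1 i r
  set D := (p.eval 0)⁻¹ • Polynomial.aeval L p.divX with hD
  have hdiff : ∀ t, S i t = x i t + ∑ j, D i j • collected G x j t := by
    intro t
    rw [hcomb]
    simp only [S, hQ, averagingMatrix_eq h0, ← hD, Matrix.add_apply, add_smul,
      Finset.sum_add_distrib]
    simp [Matrix.one_apply]
  have hlim : Tendsto (fun t => -∑ j, D i j • collected G x j t) atTop (𝓝 0) := by
    simpa using (tendsto_finsetSum Finset.univ fun j _ => (hcol j).const_smul (D i j)).neg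
  refine hlim.congr' ?_
  filter_upwards [eventually_ge_atTop 0] with t ht
  have h1 : S r t = NormedSpace.exp (t • A) *ᵥ S r 0 :=
    eq_exp_smul_mulVec_of_hasDerivWithinAt (hSode r) ht
  change _ = x i t - NormedSpace.exp (t • A) *ᵥ S r 0
  rw [← h1, ← hSeq, hdiff]
  abel

lemma achievesConsensus_of_isReference {x : Fin N → ℝ → Fin n → ℝ} {s : ℝ → Fin n → ℝ}
    (hs : IsReference x s) : AchievesConsensus x := by
  intro i j
  refine squeeze_zero (fun t => vecNorm_nonneg _) (fun t => ?_) (by simpa using (hs i).add (hs j))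
  have : x i t - x j t = (x i t - s t) + -(x j t - s t) := by abel
  rw [this, ← vecNorm_neg (x j t - s t)]
  exact vecNorm_add_le _ _

/-- Two reference trajectories differ by a function that tends to `0` and is continuous on `[0, ∞)`,
hence bounded there. -/
lemma exists_bound_of_isReference {x : Fin N → ℝ → Fin n → ℝ} {s s' : ℝ → Fin n → ℝ} (i : Fin N)
    (hs : IsReference x s) (hsc : Continuous s) {κ : ℝ} (hκ : 0 < κ) {e : ℕ}
    (hb : ∀ t, 0 ≤ t → vecNorm (s t) ≤ κ * (1 + t ^ e))
    (hs' : IsReference x s') (hsc' : ContinuousOn s' (Set.Ici 0)) :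
    ∃ c, 0 < c ∧ ∀ t, 0 ≤ t → vecNorm (s' t) ≤ c * (1 + t ^ e) := by
  have hlim : Tendsto (fun t => vecNorm (s' t - s t)) atTop (𝓝 0) := by
    refine squeeze_zero (fun t => vecNorm_nonneg _) (fun t => ?_)
      (by simpa using (hs i).add (hs' i))
    have : s' t - s t = (x i t - s t) + -(x i t - s' t) := by abel
    rw [this, ← vecNorm_neg (x i t - s' t)]
    exact vecNorm_add_le _ _
  obtain ⟨T, hT⟩ := eventually_atTop.1 (hlim.eventually (ge_mem_nhds zero_lt_one))
  have hcont : ContinuousOn (fun t => vecNorm (s' t - s t)) (Set.Icc 0 T) :=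
    continuous_vecNorm.comp_continuousOn
      ((hsc'.mono fun t ht => ht.1).sub hsc.continuousOn)
  obtain ⟨M, hM⟩ := (isCompact_Icc (a := (0 : ℝ)) (b := T)).bddAbove_image hcont
  have hbd : ∀ t, 0 ≤ t → vecNorm (s' t - s t) ≤ max M 1 := by
    intro t ht
    rcases le_total t T with h1 | h1
    · exact le_max_of_le_left (hM ⟨t, ⟨ht, h1⟩, rfl⟩)
    · exact le_max_of_le_right (hT t h1)
  have hM1 : 0 < max M 1 := lt_max_of_lt_right one_pos
  refine ⟨max M 1 + κ, by positivity, fun t ht => ?_⟩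
  have h1 : vecNorm (s' t) ≤ vecNorm (s' t - s t) + vecNorm (s t) := by
    simpa using vecNorm_add_le (s' t - s t) (s t)
  have h2 : 0 ≤ t ^ e := by positivity
  have h3 : 0 ≤ max M 1 * t ^ e := by positivity
  have := hb t ht
  have := hbd t ht
  linarith

end Reference

end

end Consensus

/-! ### Choice of the threshold and assembly -/

theorem theorem2 {n m N : ℕ}
    (A : Matrix (Fin n) (Fin n) ℝ) (B : Fin 3 → Matrix (Fin n) (Fin m) ℝ)
    -- the delays `0 ≤ τ₁ ≤ τ₂ ≤ τ₃`
    (τ : Fin 3 → ℝ) (hτ0 : 0 ≤ τ 0) (hτ1 : τ 0 ≤ τ 1) (hτ2 : τ 1 ≤ τ 2)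
    -- `(A, B)` is controllable and all eigenvalues of `A` are on the imaginary axis
    (hctrl : Consensus.IsControllable A (Consensus.delayFreeInput A B τ))
    (himag : ∀ l ∈ Consensus.eigenvalueMultiset A, l.re = 0)
    -- the eigenvalues `λ₂, …, λ_N` of the Laplacian, and `μ`
    (Λ : Multiset ℂ) (μ : ℝ) (hμ : 0 < μ) (hμΛ : ∀ l ∈ Λ, 1 / l.re ≤ μ) :
    ∃ γs : ℝ, 0 < γs ∧
      ∀ G : Consensus.WeightedDigraph N, G.HasDirectedSpanningTree →
        Consensus.eigenvalueMultiset G.laplacian = 0 ::ₘ Λ →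
        ∀ γ : ℝ, 0 < γ → γ < γs →
          -- the Riccati equation has a unique positive definite solution `P`
          ∃ P : Matrix (Fin n) (Fin n) ℝ,
            Consensus.IsPosDefRiccatiSolution A (Consensus.delayFreeInput A B τ) γ P ∧
            (∀ Q, Consensus.IsPosDefRiccatiSolution A (Consensus.delayFreeInput A B τ) γ Q →
              Q = P) ∧
            -- `k` is a positive function of the initial conditions
            ∃ k : (Fin N → C(Set.Icc (-τ 2) 0, Fin n → ℝ)) → ℝ, (∀ φ, 0 < k φ) ∧
              ∀ (φ : Fin N → C(Set.Icc (-τ 2) 0, Fin n → ℝ))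
                (x : Fin N → ℝ → Fin n → ℝ) (u : Fin N → ℝ → Fin m → ℝ),
                Consensus.IsClosedLoopTrajectory A B τ G
                  (Consensus.protocolGain A (Consensus.delayFreeInput A B τ)
                    (-((Consensus.delayFreeInput A B τ)ᵀ * P)) μ (Consensus.totalDelay τ)) x u →
                (∀ i (θ : Set.Icc (-τ 2) 0), x i θ = φ i θ) →
                Consensus.AchievesConsensus x ∧
                (∃ s : ℝ → Fin n → ℝ, Continuous s ∧ Consensus.IsReference x s ∧
                  ∀ t, 0 ≤ t → Consensus.vecNorm (s t) ≤
                    k φ * (1 + t ^ (Consensus.maxAlgMultiplicity A - 1))) ∧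
                -- every other continuous reference trajectory obeys the same growth bound
                (∀ s : ℝ → Fin n → ℝ, ContinuousOn s (Set.Ici 0) → Consensus.IsReference x s →
                  ∃ c : ℝ, 0 < c ∧ ∀ t, 0 ≤ t → Consensus.vecNorm (s t) ≤
                    c * (1 + t ^ (Consensus.maxAlgMultiplicity A - 1))) := by
  have hτnn : ∀ k, 0 ≤ τ k := by
    intro k; fin_cases k <;> simp <;> linarith
  have hτle : ∀ k, τ k ≤ τ 2 := by
    intro k; fin_cases k <;> simp <;> linarith
  obtain ⟨P₁, hP₁, -⟩ := Consensus.exists_unique_riccati hctrl himag one_pos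
  have htr0 : ∀ k, 0 ≤ ((B k)ᵀ * P₁ * B k).trace := fun k => by
    have h := hP₁.posDef.posSemidef.conjTranspose_mul_mul_same (B k)
    rw [Matrix.conjTranspose_eq_transpose_of_trivial] at h
    exact h.trace_nonneg
  -- The value at `γ = 1` dominates all smaller `γ`, so `b` can be chosen before `γ`.
  set b := √(∑ k, ((B k)ᵀ * P₁ * B k).trace) with hb
  have hbk : ∀ k, ((B k)ᵀ * P₁ * B k).trace ≤ b ^ 2 := fun k => by
    rw [hb, Real.sq_sqrt (Finset.sum_nonneg fun k _ => htr0 k)]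
    exact Finset.single_le_sum (f := fun k => ((B k)ᵀ * P₁ * B k).trace) (fun k _ => htr0 k)
      (Finset.mem_univ k)
  -- Any bound on the moduli would do; this one depends on the graph only through `Λ`.
  set ℓ := (Λ.map fun l => ‖l‖).sum with hℓ
  have hℓΛ : ∀ l ∈ Λ, ‖l‖ ≤ ℓ := fun l hl =>
    Multiset.single_le_sum (fun y hy => by
      obtain ⟨z, -, rfl⟩ := Multiset.mem_map.1 hy
      exact norm_nonneg z) _ (Multiset.mem_map_of_mem _ hl)
  set C := Consensus.lyapunovConst (n + 1) b μ ℓ (τ 2) (Consensus.totalDelay τ)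
    + Consensus.reductionConst (n + 1) b μ ℓ (τ 2) (Consensus.totalDelay τ) with hC
  have hC0 : 0 < 2 * (|C| + 1) := by positivity
  -- The square makes `C √γ ≤ 1/2`, and the cap `1` allows the comparison with `P₁`.
  refine ⟨min 1 ((1 / (2 * (|C| + 1))) ^ 2), by positivity, fun G hG hΛ γ hγ hγs => ?_⟩
  have hγ1 : γ ≤ 1 := (hγs.trans_le (min_le_left _ _)).le
  have hsmall : C * √γ ≤ 1 / 2 := by
    have h1 : √γ ≤ 1 / (2 * (|C| + 1)) :=
      Real.sqrt_le_iff.2 ⟨by positivity, (hγs.trans_le (min_le_right _ _)).le⟩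
    have h2 : √γ * (2 * (|C| + 1)) ≤ 1 := (le_div_iff₀ hC0).1 h1
    have h3 : C * √γ ≤ |C| * √γ := by gcongr; exact le_abs_self C
    have h4 := Real.sqrt_nonneg γ
    linarith
  obtain ⟨P, hP, huniq⟩ := Consensus.exists_unique_riccati hctrl himag hγ
  have hre : ∀ l ∈ Λ, 0 < l.re := fun l hl =>
    Consensus.WeightedDigraph.re_pos_of_eigenvalueMultiset_eq hG hΛ hl
  have hμΛ' : ∀ l ∈ Λ, 1 ≤ μ * l.re := fun l hl => (div_le_iff₀ (hre l hl)).1 (hμΛ l hl)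
  have hbP : ∀ k, ((B k)ᵀ * P * B k).trace ≤ b ^ 2 := fun k => by
    refine le_trans ?_ (hbk k)
    rw [Consensus.trace_conj_eq_sum, Consensus.trace_conj_eq_sum]
    exact Finset.sum_le_sum fun j _ => hP.dotProduct_mulVec_le hP₁ himag hγ hγ1 _
  obtain ⟨p, hp, hp0⟩ := Consensus.exists_charpoly_eq_X_mul hΛ
    (fun h => lt_irrefl (0 : ℝ) (by simpa using hre 0 h))
  obtain ⟨r⟩ : Nonempty (Fin N) := let ⟨_, r, _⟩ := hG; ⟨r⟩
  obtain ⟨c, hc0, hc⟩ := Consensus.exists_vecNorm_exp_smul_le A himag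
  let s₀ : (Fin N → C(Set.Icc (-τ 2) 0, Fin n → ℝ)) → Fin n → ℝ := fun φ =>
    ∑ j, Consensus.averagingMatrix G.laplacian p r j •
      φ j ⟨0, neg_nonpos.2 (hτnn 2), le_rfl⟩
  have hk : ∀ φ, 0 < c * (1 + ∑ a, |s₀ φ a|) := fun φ => by positivity
  refine ⟨P, hP, huniq, fun φ => c * (1 + ∑ a, |s₀ φ a|), hk, fun φ x u hx hφ => ?_⟩
  have hcol := Consensus.tendsto_collected_zero hτnn hτle himag hΛ hμ hμΛ' hℓΛ hγ hγ1 hP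
    (Real.sqrt_nonneg _) hbP hsmall hx
  have hs₀ : ∑ j, Consensus.averagingMatrix G.laplacian p r j • x j 0 = s₀ φ :=
    Finset.sum_congr rfl fun j _ => by
      rw [← hφ j ⟨0, neg_nonpos.2 (hτnn 2), le_rfl⟩]
  have hsc : Continuous fun t : ℝ => NormedSpace.exp (t • A) *ᵥ s₀ φ :=
    continuous_iff_continuousAt.2 fun t =>
      (Consensus.hasDerivAt_exp_smul_mulVec A (s₀ φ) t).continuousAt
  have href : Consensus.IsReference x fun t => NormedSpace.exp (t • A) *ᵥ s₀ φ := fun i => by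
    have h := Consensus.tendsto_sub_average hx hτle hG hp hp0 hcol r i
    rw [hs₀] at h
    exact Consensus.tendsto_vecNorm_zero h
  refine ⟨Consensus.achievesConsensus_of_isReference href,
    ⟨_, hsc, href, fun t ht => hc t ht (s₀ φ)⟩, fun s hs hsref => ?_⟩
  exact Consensus.exists_bound_of_isReference r href hsc (hk φ) (fun t ht => hc t ht (s₀ φ))
    hsref hs
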